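/- Let $m,n\ge 0$ be integers and let $\theta$ be a permutation of $\{1,\dots,m\}\times\{1,\dots,n\}$. Let $\mathbb{F}_\theta^+$ be the unital semigroup generated by $e_1,\dots,e_m,f_1,\dots,f_n$ with the relations $e_if_j=f_{j'}e_{i'}$ where $\theta(i,j)=(i',j')$; for words $u=i_1\cdots i_k$, $v=j_1\cdots j_l$ write $e_u=e_{i_1}\cdots e_{i_k}$, $f_v=f_{j_1}\cdots f_{j_l}$. A $*$-representation is a unital homomorphism $\pi$ of $\mathbb{F}_\theta^+$ into the isometries of a Hilbert space with $\sum_i\pi(e_i)\pi(e_i)^*=I=\sum_j\pi(f_j)\pi(f_j)^*$. It is atomic if there is an orthonormal basis $\{\xi_x\}$ such that each $\pi(w)$ maps each $\xi_x$ to a scalar multiple, with scalar in $\mathbb{T}\cup\{0\}$, of some $\xi_y$; its graph has as vertices the lines $\dot\xi_x=\mathbb{C}\xi_x$, a blue edge $\dot\xi_x\to\dot\xi_y$ if $\pi(e_i)\dot\xi_x=\dot\xi_y$ for some $i$, and a red edge if $\pi(f_j)\dot\xi_x=\dot\xi_y$ for some $j$. An atomic $*$-representation (with its basis) is of ring by tail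 type if its graph is (non-empty and) connected, each connected component of the blue graph contains a ring (a directed cycle), and each connected component of the red graph is of infinite tail type (it contains distinct vertices $y_0,y_1,\dots$ with red edges $\cdots\to y_2\to y_1\to y_0$). Ring by tail data consist of an integer $k\ge1$, a word $u_0=i_{k-1,0}\cdots i_{0,0}$ of length $k$ in $\{1,\dots,m\}$, a scalar $\alpha\in\mathbb{T}$, an infinite word $v_0=j_{0,-1}j_{0,-2}\cdots$ in $\{1,\dots,n\}$, and integers $0>t_1>t_2>\cdots$ such that $e_{u_0}f_{v_0(0,t_r]}=f_{v_0(0,t_r]}e_{u_0}$ for all $r\ge1$, where $v_0(0,t]=j_{0,-1}\cdots j_{0,t}$. A ring by tail representation $\pi$ has these data at the basis vector $\xi$ if $k$ is the minimal size of a blue ring, $\pi(e_{u_0})\xi=\alpha^k\xi$, and for each $t\le 0$ some basis line is mapped onto $\dot\xi$ by $\pi(f_{v_0(0,t]})$. A group construction representation on $G=\mathcal{C}_k\times\mathbb{Z}$, with generators $\mathfrak{g}_1=(1,0)$ and $\mathfrak{g}_2=(0,1)$, is the representation $\sigma$ on $\ell^2(G)$ with $\sigma(e_i)\xi_g=\delta_{i\,i_g}\alpha_g\xi_{g+\mathfrak{g}_1}$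 and $\sigma(f_j)\xi_g=\delta_{j\,j_g}\beta_g\xi_{g+\mathfrak{g}_2}$, for functions $i:G\to\{1,\dots,m\}$, $j:G\to\{1,\dots,n\}$ and $\alpha,\beta:G\to\mathbb{T}$ such that for all $g$ the defining relation $e_{i_{g+\mathfrak{g}_2}}f_{j_g}=f_{j_{g+\mathfrak{g}_1}}e_{i_g}$ holds and $\alpha_{g+\mathfrak{g}_2}\beta_g=\beta_{g+\mathfrak{g}_1}\alpha_g$. A minimal $*$-dilation of $\sigma$ is a $*$-representation $\pi$ on a Hilbert space $\mathcal{K}\supset\ell^2(G)$ with $\sigma(w)=P_{\ell^2(G)}\pi(w)|_{\ell^2(G)}$ for all $w$ and $\mathcal{K}=\bigvee_w\pi(w)\ell^2(G)$. Theorem. (1) Every ring by tail atomic $*$-representation has ring by tail data at some vector of its basis. (2) Two ring by tail representations which have the same data are unitarily equivalent. (3) For all ring by tail data there is a ring by tail representation which has them. (4) A ring by tail representation which has given data at $\xi$ is the minimal $*$-dilation of a group construction representation on $\mathcal{C}_k\times\mathbb{Z}$ for which $i_{(s,0)}=i_{s,0}$ for $0\le s<k$, $j_{(0,t)}=j_{0,t}$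 for $t<0$, $\alpha_g=\alpha$ and $\beta_g=1$ for all $g$, and the basis vector at $(0,0)$ is $\xi$. (5) Conversely, for each $k\ge1$, every minimal $*$-dilation of a group construction representation on $\mathcal{C}_k\times\mathbb{Z}$ is a ring by tail atomic $*$-representation, with respect to an orthonormal basis which contains the standard basis of $\ell^2(\mathcal{C}_k\times\mathbb{Z})$, and its blue rings have minimal size $k$. -/

import Mathlib

open scoped InnerProductSpace

noncomputable section

namespace RankTwo

/-! ### The semigroup of a single vertex rank 2 graph -/

section Semigroup

variable {m n : ℕ}

/-- The commutation relations `e_i f_j = f_{j'} e_{i'}`, where `θ (i, j) = (i', j')`, on the free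
monoid with letters `e_i` (left summand) and `f_j` (right summand). -/
inductive CommRel (θ : Equiv.Perm (Fin m × Fin n)) :
    FreeMonoid (Fin m ⊕ Fin n) → FreeMonoid (Fin m ⊕ Fin n) → Prop
  | comm (i : Fin m) (j : Fin n) : CommRel θ
      (FreeMonoid.of (Sum.inl i) * FreeMonoid.of (Sum.inr j))
      (FreeMonoid.of (Sum.inr (θ (i, j)).2) * FreeMonoid.of (Sum.inl (θ (i, j)).1))

/-- The semigroup `𝔽_θ⁺` (with identity). -/
abbrev FTheta (θ : Equiv.Perm (Fin m × Fin n)) : Type := PresentedMonoid (CommRel θ)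

variable (θ : Equiv.Perm (Fin m × Fin n))

/-- The generator `e_i`. -/
def e (i : Fin m) : FTheta θ := PresentedMonoid.of (CommRel θ) (Sum.inl i)

/-- The generator `f_j`. -/
def f (j : Fin n) : FTheta θ := PresentedMonoid.of (CommRel θ) (Sum.inr j)

/-- `e_u = e_{i_{k-1}} ⋯ e_{i_0}` for a word `u = i_{k-1} ⋯ i_0`. -/
def eWord (u : List (Fin m)) : FTheta θ := (u.map (e θ)).prod

/-- `f_v = f_{j_1} ⋯ f_{j_l}` for a word `v = j_1 ⋯ j_l`. -/
def fWord (v : List (Fin n)) : FTheta θ := (v.map (f θ)).prod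

end Semigroup

/-! ### Representations -/

section Representations

variable {m n : ℕ} {θ : Equiv.Perm (Fin m × Fin n)}
variable {H : Type*} [NormedAddCommGroup H] [InnerProductSpace ℂ H] [CompleteSpace H]
variable {ι : Type*}

/-- An isometric representation. -/
def IsIsometricRep (π : FTheta θ →* (H →L[ℂ] H)) : Prop :=
  ∀ w, Isometry (π w)

/-- A partially isometric representation: each `a = π w` satisfies `a a* a = a`. -/
def IsPartiallyIsometricRep (π : FTheta θ →* (H →L[ℂ] H)) : Prop :=
  ∀ w, π w * star (π w) * π w = π w

/-- A defect free representation. -/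
def IsDefectFree (π : FTheta θ →* (H →L[ℂ] H)) : Prop :=
  ∑ i : Fin m, π (e θ i) * star (π (e θ i)) = 1 ∧
    ∑ j : Fin n, π (f θ j) * star (π (f θ j)) = 1

/-- A `*`-representation: isometric and defect free. -/
structure IsStarRep (π : FTheta θ →* (H →L[ℂ] H)) : Prop where
  isometric : IsIsometricRep π
  defectFree : IsDefectFree π

/-- `π` is atomic with respect to the orthonormal basis `b`: it is partially isometric, and the
basis is permuted, up to scalars in `𝕋 ∪ {0}`, by each `π w`. -/
structure IsAtomic (π : FTheta θ →* (H →L[ℂ] H)) (b : HilbertBasis ι ℂ H) : Prop where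
  partiallyIsometric : IsPartiallyIsometricRep π
  permutes : ∀ (w : FTheta θ) (x : ι), ∃ (y : ι) (c : ℂ),
    (‖c‖ = 1 ∨ c = 0) ∧ π w (b x) = c • b y

/-- `π w` maps the line `ℂ b_x` onto the line `ℂ b_y`, by a unimodular scalar. -/
def Moves (π : FTheta θ →* (H →L[ℂ] H)) (b : HilbertBasis ι ℂ H) (w : FTheta θ)
    (x y : ι) : Prop :=
  ∃ c : ℂ, ‖c‖ = 1 ∧ π w (b x) = c • b y

/-- There is a blue edge from `x` to `y` in the graph of `π`. -/
def BlueEdge (π : FTheta θ →* (H →L[ℂ] H)) (b : HilbertBasis ι ℂ H) (x y : ι) : Prop :=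
  ∃ i : Fin m, Moves π b (e θ i) x y

/-- There is a red edge from `x` to `y` in the graph of `π`. -/
def RedEdge (π : FTheta θ →* (H →L[ℂ] H)) (b : HilbertBasis ι ℂ H) (x y : ι) : Prop :=
  ∃ j : Fin n, Moves π b (f θ j) x y

/-- The graph of `π` is connected (and has a vertex). -/
def IsConnectedGraph (π : FTheta θ →* (H →L[ℂ] H)) (b : HilbertBasis ι ℂ H) : Prop :=
  Nonempty ι ∧
    ∀ x y, Relation.EqvGen (fun x y => BlueEdge π b x y ∨ RedEdge π b x y) x y

/-- Ring by tail atomic `*`-representations: the graph is connected, each blue component contains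
a ring, and each red component is of infinite tail type, that is, it contains pairwise distinct
vertices `y 0, y 1, …` with red edges `⋯ → y 2 → y 1 → y 0`.  (Each vertex has exactly one red edge
leading into it, so a component with a ring contains no such sequence.) -/
structure IsRingByTail (π : FTheta θ →* (H →L[ℂ] H)) (b : HilbertBasis ι ℂ H) : Prop where
  starRep : IsStarRep π
  atomic : IsAtomic π b
  connected : IsConnectedGraph π b
  blue_ring : ∀ x, ∃ (y : ι) (u : List (Fin m)),
    Relation.EqvGen (BlueEdge π b) x y ∧ u ≠ [] ∧ Moves π b (eWord θ u) y y
  red_tail : ∀ x, ∃ y : ℕ → ι, Function.Injective y ∧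
    (∀ t, Relation.EqvGen (RedEdge π b) x (y t)) ∧ ∀ t, RedEdge π b (y (t + 1)) (y t)

/-- The lengths of the nonempty closed blue paths in the graph of `π`.  The least element is the
minimal size of a blue ring. -/
def blueReturnLengths (π : FTheta θ →* (H →L[ℂ] H)) (b : HilbertBasis ι ℂ H) : Set ℕ :=
  {l | ∃ (x : ι) (u : List (Fin m)), u ≠ [] ∧ u.length = l ∧ Moves π b (eWord θ u) x x}

/-- Unitary equivalence of representations. -/
def UnitarilyEquivalent {H' : Type*} [NormedAddCommGroup H'] [InnerProductSpace ℂ H']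
    (π : FTheta θ →* (H →L[ℂ] H)) (π' : FTheta θ →* (H' →L[ℂ] H')) : Prop :=
  ∃ U : H ≃ₗᵢ[ℂ] H', ∀ w h, U (π w h) = π' w (U h)

/-- `π`, on `K`, is a minimal `*`-dilation of `σ`, on `H`, where `H` is regarded as a subspace of
`K` through the isometry `V`: `π` is a `*`-representation, `σ w` is the compression of `π w`, and
the vectors `π w (V x)` span a dense subspace of `K`. -/
structure IsMinimalStarDilation {K : Type*} [NormedAddCommGroup K] [InnerProductSpace ℂ K]
    [CompleteSpace K] (σ : FTheta θ →* (H →L[ℂ] H)) (π : FTheta θ →* (K →L[ℂ] K))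
    (V : H →ₗᵢ[ℂ] K) : Prop where
  starRep : IsStarRep π
  dilation : ∀ (w : FTheta θ) (x y : H), ⟪V y, π w (V x)⟫_ℂ = ⟪y, σ w x⟫_ℂ
  minimal : (Submodule.span ℂ {z : K | ∃ (w : FTheta θ) (x : H),
    z = π w (V x)}).topologicalClosure = ⊤

end Representations

/-! ### Ring by tail data -/

section Data

variable {m n : ℕ}

/-- The data of a ring by tail representation with rings of length `k`. -/
structure RingTailData (θ : Equiv.Perm (Fin m × Fin n)) (k : ℕ) where
  /-- the word `u₀ = i_{k-1,0} ⋯ i_{0,0}` (first letter `i_{k-1,0}`) -/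
  u : List (Fin m)
  length_u : u.length = k
  k_pos : 0 < k
  /-- the scalar -/
  α : Circle
  /-- the infinite word `v₀ = j_{0,-1} j_{0,-2} ⋯`, with `v t = j_{0,-t-1}` -/
  v : ℕ → Fin n
  /-- the sequence of the `-t_r`, so that `0 > t₁ > t₂ > ⋯` -/
  t : ℕ → ℕ
  t_pos : ∀ r, 0 < t r
  t_strictMono : StrictMono t
  /-- `e_{u₀}` commutes with the initial segment of `v₀` of length `-t_r` -/
  commute : ∀ r, eWord θ u * fWord θ ((List.range (t r)).map v) =
    fWord θ ((List.range (t r)).map v) * eWord θ u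

/-- `π` has the data `D` at the basis vector `b x`: the minimal size of a blue ring is `k`, the
vector `b x` lies on such a ring with word `u₀` and scalar `α ^ k`, and pulling back from `b x`
along the red edges yields the infinite word `v₀`. -/
structure HasData {θ : Equiv.Perm (Fin m × Fin n)} {k : ℕ} {H : Type*} [NormedAddCommGroup H]
    [InnerProductSpace ℂ H] [CompleteSpace H] {ι : Type*}
    (π : FTheta θ →* (H →L[ℂ] H)) (b : HilbertBasis ι ℂ H) (x : ι)
    (D : RingTailData θ k) : Prop where
  minimal : IsLeast (blueReturnLengths π b) k
  ring : π (eWord θ D.u) (b x) = ((D.α : ℂ) ^ k) • b x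
  tail : ∀ t : ℕ, ∃ y, Moves π b (fWord θ ((List.range t).map D.v)) y x

end Data

/-! ### The group construction -/

section GroupConstruction

variable {G : Type*} [AddCommGroup G]

/-- The Hilbert space `ℓ²(G)`. -/
abbrev EllTwo (G : Type*) : Type _ := lp (fun _ : G => ℂ) 2

theorem summable_shift (a : G) (φ : G → ℂ) (hφ : ∀ g, ‖φ g‖ ≤ 1) (x : EllTwo G) :
    Summable (fun h => ‖φ (h - a) * x (h - a)‖ ^ (2 : ENNReal).toReal) ∧
      ∑' h, ‖φ (h - a) * x (h - a)‖ ^ (2 : ENNReal).toReal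
        ≤ ∑' h, ‖x h‖ ^ (2 : ENNReal).toReal := by
  have h2 : 0 < (2 : ENNReal).toReal := by norm_num
  have hx : Summable (fun h => ‖x h‖ ^ (2 : ENNReal).toReal) :=
    (memℓp_gen_iff h2).1 (lp.memℓp x)
  have hx' : Summable (fun h => ‖x (h - a)‖ ^ (2 : ENNReal).toReal) :=
    (Equiv.subRight a).summable_iff.2 hx
  have hle : ∀ h, ‖φ (h - a) * x (h - a)‖ ^ (2 : ENNReal).toReal
      ≤ ‖x (h - a)‖ ^ (2 : ENNReal).toReal := fun h => by
    refine Real.rpow_le_rpow (norm_nonneg _) ?_ h2.le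
    rw [norm_mul]
    exact mul_le_of_le_one_left (norm_nonneg _) (hφ _)
  have hs := Summable.of_nonneg_of_le (fun h => by positivity) hle hx'
  refine ⟨hs, (hs.tsum_le_tsum hle hx').trans (le_of_eq ?_)⟩
  exact (Equiv.subRight a).tsum_eq (fun h => ‖x h‖ ^ (2 : ENNReal).toReal)

/-- The operator on `ℓ²(G)` with `ξ_g ↦ φ(g) ξ_{g + a}`, for `|φ| ≤ 1`. -/
def weightedShift (a : G) (φ : G → ℂ) (hφ : ∀ g, ‖φ g‖ ≤ 1) : EllTwo G →L[ℂ] EllTwo G :=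
  LinearMap.mkContinuous
    { toFun := fun x => ⟨fun h => φ (h - a) * x (h - a),
        memℓp_gen (summable_shift a φ hφ x).1⟩
      map_add' := fun x y => by
        ext h
        exact mul_add _ _ _
      map_smul' := fun c x => by
        ext h
        exact mul_left_comm _ _ _ }
    1
    (fun x => by
      have h2 : 0 < (2 : ENNReal).toReal := by norm_num
      rw [one_mul]
      refine lp.norm_le_of_tsum_le h2 (norm_nonneg _) ?_
      rw [lp.norm_rpow_eq_tsum h2]
      exact (summable_shift a φ hφ x).2)

theorem weightedShift_apply (a : G) (φ : G → ℂ) (hφ : ∀ g, ‖φ g‖ ≤ 1) (x : EllTwo G) (h : G) :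
    weightedShift a φ hφ x h = φ (h - a) * x (h - a) := rfl

variable {m n : ℕ}

/-- The data of a group construction on an abelian group `G` with two designated generators
`g₁`, `g₂`.  By the definition of the relations of `𝔽_θ⁺`, the condition `comm` says that
`e_{i(g + g₂)} f_{j(g)} = f_{j(g + g₁)} e_{i(g)}`. -/
structure GroupData (θ : Equiv.Perm (Fin m × Fin n)) (G : Type*) [AddCommGroup G]
    (g₁ g₂ : G) where
  generate : AddSubgroup.closure {g₁, g₂} = ⊤
  i : G → Fin m
  j : G → Fin n
  α : G → Circle
  β : G → Circle
  comm : ∀ g, θ (i (g + g₂), j g) = (i g, j (g + g₁))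
  comm_scalar : ∀ g, α (g + g₂) * β g = β (g + g₁) * α g

namespace GroupData

variable {θ : Equiv.Perm (Fin m × Fin n)} {g₁ g₂ : G} (D : GroupData θ G g₁ g₂)

/-- The operator `ξ_g ↦ δ_{i, i_g} α_g ξ_{g + g₁}`. -/
def E (i : Fin m) : EllTwo G →L[ℂ] EllTwo G :=
  weightedShift g₁ (fun g => if i = D.i g then (D.α g : ℂ) else 0)
    (fun g => by
      split_ifs
      · exact (Circle.norm_coe _).le
      · exact norm_zero.trans_le zero_le_one)

/-- The operator `ξ_g ↦ δ_{j, j_g} β_g ξ_{g + g₂}`. -/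
def F (j : Fin n) : EllTwo G →L[ℂ] EllTwo G :=
  weightedShift g₂ (fun g => if j = D.j g then (D.β g : ℂ) else 0)
    (fun g => by
      split_ifs
      · exact (Circle.norm_coe _).le
      · exact norm_zero.trans_le zero_le_one)

theorem E_F (i : Fin m) (j : Fin n) :
    D.E i * D.F j = D.F (θ (i, j)).2 * D.E (θ (i, j)).1 := by
  ext x h
  obtain ⟨g, rfl⟩ : ∃ g, h = g + g₁ + g₂ := ⟨h - g₁ - g₂, by abel⟩
  have e1 : g + g₁ + g₂ - g₁ = g + g₂ := by abel
  have e2 : g + g₁ + g₂ - g₂ = g + g₁ := by abel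
  have key : (i = D.i (g + g₂) ∧ j = D.j g) ↔
      ((θ (i, j)).2 = D.j (g + g₁) ∧ (θ (i, j)).1 = D.i g) := by
    rw [← Prod.mk.injEq, ← θ.injective.eq_iff, D.comm, Prod.ext_iff]
    exact and_comm
  have hs : (D.α (g + g₂) : ℂ) * D.β g = D.β (g + g₁) * D.α g := by
    rw [← Circle.coe_mul, ← Circle.coe_mul, D.comm_scalar]
  simp only [mul_apply_eq_comp, E, F, weightedShift_apply, e1, e2,
    add_sub_cancel_right, ← mul_assoc, ite_mul, mul_ite, zero_mul, mul_zero, ← ite_and]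
  by_cases hc : i = D.i (g + g₂) ∧ j = D.j g
  · rw [if_pos hc.symm, if_pos (key.1 hc).symm, hs]
  · rw [if_neg (fun h => hc h.symm), if_neg (fun h => hc (key.2 h.symm))]

/-- The group construction representation on `ℓ²(G)`:
`σ(e_i) ξ_g = δ_{i, i_g} α_g ξ_{g + g₁}` and `σ(f_j) ξ_g = δ_{j, j_g} β_g ξ_{g + g₂}`. -/
def rep : FTheta θ →* (EllTwo G →L[ℂ] EllTwo G) :=
  PresentedMonoid.lift (Sum.elim D.E D.F) (by
    rintro _ _ ⟨i, j⟩
    simpa using D.E_F i j)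

theorem rep_e (i : Fin m) : D.rep (e θ i) = D.E i := rfl

theorem rep_f (j : Fin n) : D.rep (f θ j) = D.F j := rfl

end GroupData

/-- The group construction `𝒢` on `𝒞_k × ℤ` is built from the ring by tail data `D`: the blue
ring at height `0` is labelled by `u₀`, the red path leading down from `(0, 0)` is labelled by
`v₀`, the blue scalar is constantly `α` and the red scalar is constantly `1`. -/
structure Realizes {θ : Equiv.Perm (Fin m × Fin n)} {k : ℕ}
    (𝒢 : GroupData θ (ZMod k × ℤ) (1, 0) (0, 1)) (D : RingTailData θ k) : Prop where
  ring : D.u = (List.ofFn fun s : Fin k => 𝒢.i (((s : ℕ) : ZMod k), 0)).reverse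
  tail : ∀ t : ℕ, D.v t = 𝒢.j (0, -((t : ℤ) + 1))
  scalar_blue : ∀ g, 𝒢.α g = D.α
  scalar_red : ∀ g, 𝒢.β g = 1

end GroupConstruction

end RankTwo

end

/-!
In a ring by tail representation each vertex has exactly one blue and one red predecessor, the words
of the two paths backwards are unique, and steps backwards in the two colours commute. Everything
rests on this and on unique factorization in `𝔽_θ⁺` (`e_mul_inj`, `f_mul_inj`,
`fWord_mul_eWord_inj`), which comes from an explicit action on the normal forms `f_v e_u`.

*Dilations of a group construction* are described without any choice: a pair `(g, w)` stands for the
line of `π(w) ξ_g`, and `(g, w)` may be replaced by the pairs `blueBack (g, w)` and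
`redBack (g, w)`, which express `ξ_g` by the vectors at `g - g₁` and `g - g₂`. The set of pairs up
to such steps is `GroupData.Vertex`, a direct limit of copies of `𝔽_θ⁺`, on which `𝔽_θ⁺` acts. In a
minimal `*`-dilation two pairs give the same line if they give the same vertex, and orthogonal lines
otherwise, since after enough steps backwards the two words have the same degree
(`IsCarrier.inner_atom`). So each minimal `*`-dilation has an orthonormal basis indexed by
`GroupData.Vertex`, and the scalars with which the words act depend on the group construction only.
This gives uniqueness of the dilation (`IsCarrier.unitarilyEquivalent`), and it reduces the
description of its graph to the action on `GroupData.Vertex`. On `𝒞_k × ℤ`, if a path leads from a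
vertex to itself then its red degree vanishes and its blue degree is divisible by `k`; blue rings
exist because the vertices `f_v ξ_{(s,t)}` with a given length of `v` and a given `t` form a finite
set which is closed under blue steps backwards (`IsCarrier.isRingByTail`). Conversely,
`GroupData.model` is a minimal `*`-dilation on `ℓ²` of the set of vertices.

*From data to a group construction.* The word `u₀` on the top row and the infinite word `v₀` on the
left column determine all the labels below by `θ`. The commutation relations of the data, with
unique factorization, say that the right boundary of the strip of width `k` is `v₀` again, so that
the labels are periodic, and that the row at each height `t_r` is `u₀`. Hence the strip between `t₁`
and `0` can be repeated above height `0` (`RingTailData.groupData`).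

*From a representation to data.* Going backwards from a minimal blue ring along red edges one meets
blue rings of the same size; by the pigeonhole principle one word occurs infinitely often, and the
data are read off at its first occurrence (`IsRingByTail.exists_hasData`). Given data at `ξ`, the
vectors found by following the labels of the group construction from `ξ` are distinct multiples of
basis vectors: a coincidence would give a shorter blue ring or a red ring (`injective_of_moves`).
They span a copy of `ℓ²(𝒞_k × ℤ)` which generates the space, because the graph is connected
(`HasData.exists_isCarrier`).
-/

open scoped InnerProductSpace

noncomputable section

namespace RankTwo

/-! ### Factorization in the semigroup -/

section Semigroup

variable {m n : ℕ} {θ : Equiv.Perm (Fin m × Fin n)}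

theorem e_mul_f (i : Fin m) (j : Fin n) :
    e θ i * f θ j = f θ (θ (i, j)).2 * e θ (θ (i, j)).1 :=
  PresentedMonoid.mk_eq_mk_of_rel (CommRel.comm i j)

/-- A property of elements of `𝔽_θ⁺` holds if it holds for `1` and is inherited under left
multiplication by generators. -/
theorem FTheta.induction {p : FTheta θ → Prop} (one : p 1)
    (e_mul : ∀ i w, p w → p (e θ i * w)) (f_mul : ∀ j w, p w → p (f θ j * w)) (w : FTheta θ) :
    p w := by
  obtain ⟨a, rfl⟩ := PresentedMonoid.surjective_mk w
  induction a using FreeMonoid.inductionOn' with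
  | one => exact one
  | of_mul x xs ih =>
    rw [map_mul]
    rcases x with i | j
    · exact e_mul i _ ih
    · exact f_mul j _ ih

theorem eWord_nil : eWord θ [] = 1 := rfl

theorem eWord_cons (i : Fin m) (u : List (Fin m)) : eWord θ (i :: u) = e θ i * eWord θ u := by
  simp [eWord]

theorem fWord_cons (j : Fin n) (v : List (Fin n)) : fWord θ (j :: v) = f θ j * fWord θ v := by
  simp [fWord]

theorem eWord_append (u u' : List (Fin m)) : eWord θ (u ++ u') = eWord θ u * eWord θ u' := by
  simp [eWord]

theorem fWord_append (v v' : List (Fin n)) : fWord θ (v ++ v') = fWord θ v * fWord θ v' := by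
  simp [fWord]

theorem fWord_singleton (j : Fin n) : fWord θ [j] = f θ j := by simp [fWord]

/-- The result of moving a letter `e_i` to the right through the word `f_v`:
`e_i f_v = f_{v'} e_{i'}` for `(v', i') = pushRight θ i v`. -/
def pushRight (θ : Equiv.Perm (Fin m × Fin n)) :
    Fin m → List (Fin n) → List (Fin n) × Fin m
  | i, [] => ([], i)
  | i, j :: v => ((θ (i, j)).2 :: (pushRight θ (θ (i, j)).1 v).1, (pushRight θ (θ (i, j)).1 v).2)

theorem e_mul_fWord (i : Fin m) (v : List (Fin n)) :
    e θ i * fWord θ v = fWord θ (pushRight θ i v).1 * e θ (pushRight θ i v).2 := by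
  induction v generalizing i with
  | nil => simp [pushRight, fWord]
  | cons j v ih => rw [pushRight, fWord_cons, fWord_cons, ← mul_assoc, e_mul_f, mul_assoc, ih,
      mul_assoc]

theorem pushRight_injective {i i' : Fin m} {v v' : List (Fin n)}
    (h : pushRight θ i v = pushRight θ i' v') : i = i' ∧ v = v' := by
  induction v generalizing i i' v' with
  | nil => cases v' <;> simp_all [pushRight]
  | cons j v ih =>
    cases v' with
    | nil => simp [pushRight] at h
    | cons j' v' =>
      simp only [pushRight, Prod.mk.injEq, List.cons.injEq] at h
      obtain ⟨h1, rfl⟩ := ih (Prod.ext h.1.2 h.2)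
      simpa using θ.injective (Prod.ext h1 h.1.1)

/-- The left regular action of `𝔽_θ⁺` on itself, written in terms of the normal forms
`f_v e_u ↔ (v, u)`. -/
def normalFormAction (θ : Equiv.Perm (Fin m × Fin n)) :
    FTheta θ →* Function.End (List (Fin n) × List (Fin m)) :=
  PresentedMonoid.lift (M := Function.End (List (Fin n) × List (Fin m)))
    (Sum.elim (fun i p => ((pushRight θ i p.1).1, (pushRight θ i p.1).2 :: p.2))
      (fun j p => (j :: p.1, p.2))) (by
    rintro _ _ ⟨i, j⟩
    rfl)

theorem normalFormAction_e (i : Fin m) (p : List (Fin n) × List (Fin m)) :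
    normalFormAction θ (e θ i) p = ((pushRight θ i p.1).1, (pushRight θ i p.1).2 :: p.2) := rfl

theorem normalFormAction_f (j : Fin n) (p : List (Fin n) × List (Fin m)) :
    normalFormAction θ (f θ j) p = (j :: p.1, p.2) := rfl

/-- The pair `(v, u)` with `w = f_v e_u`, found by acting on the normal form of `1`. -/
def normalForm (w : FTheta θ) : List (Fin n) × List (Fin m) := normalFormAction θ w ([], [])

theorem normalForm_mul (w w' : FTheta θ) :
    normalForm (w * w') = normalFormAction θ w (normalForm w') := by
  rw [normalForm, map_mul]; rfl

theorem fWord_mul_eWord_normalForm (w : FTheta θ) :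
    fWord θ (normalForm w).1 * eWord θ (normalForm w).2 = w := by
  induction w using FTheta.induction with
  | one =>
    rw [normalForm, map_one]
    exact one_mul 1
  | e_mul i w ih =>
    rw [normalForm_mul, normalFormAction_e, eWord_cons, ← mul_assoc, ← e_mul_fWord, mul_assoc, ih]
  | f_mul j w ih => rw [normalForm_mul, normalFormAction_f, fWord_cons, mul_assoc, ih]

theorem normalForm_injective : Function.Injective (normalForm (θ := θ)) := fun w w' h => by
  rw [← fWord_mul_eWord_normalForm w, h, fWord_mul_eWord_normalForm]

/-- The first red letter of an element, in any factorization beginning with a red letter, and the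
rest of the factorization, are unique. -/
theorem f_mul_inj {j j' : Fin n} {w w' : FTheta θ} (h : f θ j * w = f θ j' * w') :
    j = j' ∧ w = w' := by
  have h' := congrArg normalForm h
  simp only [normalForm_mul, normalFormAction_f, Prod.mk.injEq, List.cons.injEq] at h'
  exact ⟨h'.1.1, normalForm_injective (Prod.ext h'.1.2 h'.2)⟩

/-- The first blue letter of an element, in any factorization beginning with a blue letter, and the
rest of the factorization, are unique. -/
theorem e_mul_inj {i i' : Fin m} {w w' : FTheta θ} (h : e θ i * w = e θ i' * w') :
    i = i' ∧ w = w' := by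
  have h' := congrArg normalForm h
  simp only [normalForm_mul, normalFormAction_e, Prod.mk.injEq, List.cons.injEq] at h'
  obtain ⟨h1, h2⟩ := pushRight_injective (Prod.ext h'.1 h'.2.1)
  exact ⟨h1, normalForm_injective (Prod.ext h2 h'.2.2)⟩

theorem mul_left_cancel_fTheta (w : FTheta θ) {x y : FTheta θ} (h : w * x = w * y) : x = y := by
  induction w using FTheta.induction generalizing x y with
  | one => simpa using h
  | e_mul i w ih => exact ih (e_mul_inj (by simpa only [mul_assoc] using h)).2
  | f_mul j w ih => exact ih (f_mul_inj (by simpa only [mul_assoc] using h)).2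

theorem eWord_injective {u u' : List (Fin m)} (h : eWord θ u = eWord θ u')
    (hl : u.length = u'.length) : u = u' := by
  induction u generalizing u' with
  | nil => simpa [eq_comm] using hl
  | cons i u ih =>
    cases u' with
    | nil => simp at hl
    | cons i' u' =>
      rw [eWord_cons, eWord_cons] at h
      obtain ⟨rfl, h'⟩ := e_mul_inj h
      rw [ih h' (by simpa using hl)]

/-- Uniqueness of the factorization `f_v e_u`. -/
theorem fWord_mul_eWord_inj {v v' : List (Fin n)} {u u' : List (Fin m)}
    (h : fWord θ v * eWord θ u = fWord θ v' * eWord θ u') (hv : v.length = v'.length)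
    (hu : u.length = u'.length) : v = v' ∧ u = u' := by
  induction v generalizing v' with
  | nil =>
    obtain rfl : v' = [] := by simpa [eq_comm] using hv
    exact ⟨rfl, eWord_injective (mul_left_cancel_fTheta _ h) hu⟩
  | cons j v ih =>
    cases v' with
    | nil => simp at hv
    | cons j' v' =>
      rw [fWord_cons, fWord_cons, mul_assoc, mul_assoc] at h
      obtain ⟨rfl, h'⟩ := f_mul_inj h
      obtain ⟨rfl, rfl⟩ := ih h' (by simpa using hv)
      exact ⟨rfl, rfl⟩

theorem f_mul_e (j : Fin n) (i : Fin m) :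
    f θ j * e θ i = e θ (θ.symm (i, j)).1 * f θ (θ.symm (i, j)).2 := by
  simp [e_mul_f]

theorem exists_mul_e_eq (w : FTheta θ) (i : Fin m) : ∃ i' w', w * e θ i = e θ i' * w' := by
  induction w using FTheta.induction with
  | one => exact ⟨i, 1, by simp⟩
  | e_mul a w ih => exact ⟨a, w * e θ i, mul_assoc _ _ _⟩
  | f_mul j w ih =>
    obtain ⟨i', w', h⟩ := ih
    exact ⟨_, _, by rw [mul_assoc, h, ← mul_assoc, f_mul_e, mul_assoc]⟩

theorem exists_mul_f_eq (w : FTheta θ) (j : Fin n) : ∃ j' w', w * f θ j = f θ j' * w' := by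
  induction w using FTheta.induction with
  | one => exact ⟨j, 1, by simp⟩
  | f_mul a w ih => exact ⟨a, w * f θ j, mul_assoc _ _ _⟩
  | e_mul i w ih =>
    obtain ⟨j', w', h⟩ := ih
    exact ⟨_, _, by rw [mul_assoc, h, ← mul_assoc, e_mul_f, mul_assoc]⟩

theorem exists_eWord_mul_f (u : List (Fin m)) (j : Fin n) :
    ∃ j' u', u'.length = u.length ∧ eWord θ u * f θ j = f θ j' * eWord θ u' := by
  induction u with
  | nil => exact ⟨j, [], rfl, by simp [eWord]⟩
  | cons i u ih =>
    obtain ⟨j', u', hl, h⟩ := ih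
    exact ⟨_, (θ (i, j')).1 :: u', by simp [hl], by
      rw [eWord_cons, eWord_cons, mul_assoc, h, ← mul_assoc, e_mul_f, mul_assoc]⟩

theorem exists_fWord_mul_e (v : List (Fin n)) (i : Fin m) :
    ∃ i' v', v'.length = v.length ∧ fWord θ v * e θ i = e θ i' * fWord θ v' := by
  induction v with
  | nil => exact ⟨i, [], rfl, by simp [fWord]⟩
  | cons j v ih =>
    obtain ⟨i', v', hl, h⟩ := ih
    exact ⟨_, (θ.symm (i', j)).2 :: v', by simp [hl], by
      rw [fWord_cons, fWord_cons, mul_assoc, h, ← mul_assoc, f_mul_e, mul_assoc]⟩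

/-- Every element has the form `e_u f_v`. -/
theorem exists_eq_eWord_mul_fWord (w : FTheta θ) : ∃ u v, w = eWord θ u * fWord θ v := by
  induction w using FTheta.induction with
  | one => exact ⟨[], [], by simp [eWord, fWord]⟩
  | e_mul i w ih =>
    obtain ⟨u, v, rfl⟩ := ih
    exact ⟨i :: u, v, by rw [eWord_cons, mul_assoc]⟩
  | f_mul j w ih =>
    obtain ⟨u, v, rfl⟩ := ih
    induction u generalizing j with
    | nil => exact ⟨[], j :: v, by simp [eWord, fWord_cons]⟩
    | cons i u ih =>
      obtain ⟨u', v', h⟩ := ih (θ.symm (i, j)).2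
      refine ⟨(θ.symm (i, j)).1 :: u', v', ?_⟩
      rw [eWord_cons, eWord_cons, mul_assoc, ← mul_assoc (f θ j), f_mul_e, mul_assoc, h, mul_assoc]

/-- The number of blue letters of an element, as a homomorphism. -/
def blueDegreeHom (θ : Equiv.Perm (Fin m × Fin n)) : FTheta θ →* Multiplicative ℕ :=
  PresentedMonoid.lift (Sum.elim (fun _ => Multiplicative.ofAdd 1) (fun _ => 1)) (by
    rintro _ _ ⟨i, j⟩
    simp)

/-- The number of red letters of an element, as a homomorphism. -/
def redDegreeHom (θ : Equiv.Perm (Fin m × Fin n)) : FTheta θ →* Multiplicative ℕ :=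
  PresentedMonoid.lift (Sum.elim (fun _ => 1) (fun _ => Multiplicative.ofAdd 1)) (by
    rintro _ _ ⟨i, j⟩
    simp)

/-- The number of blue letters of an element. -/
def blueDegree (w : FTheta θ) : ℕ := (blueDegreeHom θ w).toAdd

/-- The number of red letters of an element. -/
def redDegree (w : FTheta θ) : ℕ := (redDegreeHom θ w).toAdd

@[simp] theorem blueDegree_one : blueDegree (1 : FTheta θ) = 0 := by simp [blueDegree]

@[simp] theorem redDegree_one : redDegree (1 : FTheta θ) = 0 := by simp [redDegree]

@[simp] theorem blueDegree_mul (w w' : FTheta θ) :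
    blueDegree (w * w') = blueDegree w + blueDegree w' := by simp [blueDegree]

@[simp] theorem redDegree_mul (w w' : FTheta θ) :
    redDegree (w * w') = redDegree w + redDegree w' := by simp [redDegree]

@[simp] theorem blueDegree_e (i : Fin m) : blueDegree (e θ i) = 1 := rfl

@[simp] theorem redDegree_e (i : Fin m) : redDegree (e θ i) = 0 := rfl

@[simp] theorem blueDegree_f (j : Fin n) : blueDegree (f θ j) = 0 := rfl

@[simp] theorem redDegree_f (j : Fin n) : redDegree (f θ j) = 1 := rfl

@[simp] theorem blueDegree_eWord (u : List (Fin m)) : blueDegree (eWord θ u) = u.length := by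
  induction u with
  | nil => simp [eWord]
  | cons i u ih => simp [eWord_cons, ih, add_comm]

@[simp] theorem redDegree_eWord (u : List (Fin m)) : redDegree (eWord θ u) = 0 := by
  induction u with
  | nil => simp [eWord]
  | cons i u ih => simp [eWord_cons, ih]

@[simp] theorem blueDegree_fWord (v : List (Fin n)) : blueDegree (fWord θ v) = 0 := by
  induction v with
  | nil => simp [fWord]
  | cons i u ih => simp [fWord_cons, ih]

@[simp] theorem redDegree_fWord (v : List (Fin n)) : redDegree (fWord θ v) = v.length := by
  induction v with
  | nil => simp [fWord]
  | cons i u ih => simp [fWord_cons, ih, add_comm]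

theorem exists_eq_e_mul {w : FTheta θ} (h : blueDegree w ≠ 0) : ∃ i w', w = e θ i * w' := by
  obtain ⟨u, v, rfl⟩ := exists_eq_eWord_mul_fWord w
  cases u with
  | nil => simp at h
  | cons i u => exact ⟨i, _, by rw [eWord_cons, mul_assoc]⟩

theorem exists_eq_fWord {w : FTheta θ} (h : blueDegree w = 0) : ∃ v, w = fWord θ v := by
  obtain ⟨u, v, rfl⟩ := exists_eq_eWord_mul_fWord w
  obtain rfl : u = [] := by simpa using h
  exact ⟨v, by simp [eWord]⟩

end Semigroup

/-! ### Isometries with complementary ranges -/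

section Isometries

variable {H : Type*} [NormedAddCommGroup H] [InnerProductSpace ℂ H]

theorem inner_map_of_isometry {T : H →L[ℂ] H} (hT : Isometry T) (x y : H) :
    ⟪T x, T y⟫_ℂ = ⟪x, y⟫_ℂ :=
  LinearIsometry.inner_map_map (⟨T.toLinearMap, fun z => by
    simpa using hT.norm_map_of_map_zero (map_zero T) z⟩ : H →ₗᵢ[ℂ] H) x y

variable [CompleteSpace H] {κ : Type*} [Fintype κ]

/-- The Parseval identity for isometries with `∑ S_i S_i* = 1`. -/
theorem sum_norm_star_sq {S : κ → H →L[ℂ] H} (hS : ∑ i, S i * star (S i) = 1) (y : H) :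
    ∑ i, ‖star (S i) y‖ ^ 2 = ‖y‖ ^ 2 := by
  have h : ⟪(∑ i, S i * star (S i)) y, y⟫_ℂ = ⟪y, y⟫_ℂ := by rw [hS]; rfl
  rw [sum_apply, sum_inner] at h
  have h' : ∀ i, ⟪(S i * star (S i)) y, y⟫_ℂ = ((‖star (S i) y‖ ^ 2 : ℝ) : ℂ) := fun i => by
    rw [mul_apply_eq_comp, ← ContinuousLinearMap.adjoint_inner_right,
      ← ContinuousLinearMap.star_eq_adjoint, inner_self_eq_norm_sq_to_K]
    norm_cast
  simp_rw [h'] at h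
  rw [inner_self_eq_norm_sq_to_K, ← Complex.ofReal_sum] at h
  exact Complex.ofReal_injective (h.trans (by push_cast; rfl))

/-- Isometries with `∑ S_i S_i* = 1` have pairwise orthogonal ranges. -/
theorem inner_eq_zero_of_sum_eq_one {S : κ → H →L[ℂ] H} (hS : ∑ i, S i * star (S i) = 1)
    (hi : ∀ i, Isometry (S i)) {i j : κ} (hij : i ≠ j) (x y : H) : ⟪S i x, S j y⟫_ℂ = 0 := by
  classical
  -- The term at `i` already has the value `‖S i x‖²` of the sum, so the other terms vanish.
  have h := sum_norm_star_sq hS (S i x)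
  have hx : star (S i) (S i x) = x := by
    refine ext_inner_right ℂ fun z => ?_
    rw [ContinuousLinearMap.star_eq_adjoint, ContinuousLinearMap.adjoint_inner_left,
      inner_map_of_isometry (hi i)]
  rw [← Finset.add_sum_erase _ _ (Finset.mem_univ i), hx,
    (hi i).norm_map_of_map_zero (map_zero _), add_eq_left,
    Finset.sum_eq_zero_iff_of_nonneg (fun _ _ => by positivity)] at h
  have h0 : star (S j) (S i x) = 0 := by simpa using h j (by simp [hij.symm])
  rw [← ContinuousLinearMap.adjoint_inner_left, ← ContinuousLinearMap.star_eq_adjoint, h0,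
    inner_zero_left]

theorem exists_star_ne_zero {S : κ → H →L[ℂ] H} (hS : ∑ i, S i * star (S i) = 1) {y : H}
    (hy : y ≠ 0) : ∃ i, star (S i) y ≠ 0 := by
  by_contra! h
  have h' := sum_norm_star_sq hS y
  simp only [h, norm_zero, ne_eq, OfNat.ofNat_ne_zero, not_false_eq_true, zero_pow,
    Finset.sum_const_zero] at h'
  exact hy (by simpa using h'.symm)

/-- A criterion for `∑ S_i S_i* = 1` in terms of an orthonormal basis. -/
theorem sum_eq_one_of_basis {ι : Type*} {S : κ → H →L[ℂ] H} (b : HilbertBasis ι ℂ H)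
    (hi : ∀ i, Isometry (S i)) (horth : ∀ i j, i ≠ j → ∀ x y, ⟪S i x, S j y⟫_ℂ = 0)
    (hb : ∀ x, ∃ i y, b x = S i y) : ∑ i, S i * star (S i) = 1 := by
  classical
  have key : ∀ x, (∑ i, S i * star (S i)) (b x) = b x := fun x => by
    obtain ⟨i, y, h⟩ := hb x
    rw [h, sum_apply, Finset.sum_eq_single i]
    · rw [mul_apply_eq_comp]
      congr 1
      refine ext_inner_right ℂ fun z => ?_
      rw [ContinuousLinearMap.star_eq_adjoint, ContinuousLinearMap.adjoint_inner_left,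
        inner_map_of_isometry (hi i)]
    · intro j _ hj
      rw [mul_apply_eq_comp]
      convert map_zero (S j)
      refine ext_inner_right ℂ fun z => ?_
      rw [ContinuousLinearMap.star_eq_adjoint, ContinuousLinearMap.adjoint_inner_left,
        horth i j hj.symm, inner_zero_left]
    · simp
  refine ContinuousLinearMap.ext_on (s := Set.range b) ?_ ?_
  · exact Submodule.dense_iff_topologicalClosure_eq_top.2 b.dense_span
  · rintro _ ⟨x, rfl⟩
    exact key x

end Isometries

/-! ### Consequences of defect freeness -/

section StarRep

variable {m n : ℕ} {θ : Equiv.Perm (Fin m × Fin n)}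
variable {H : Type*} [NormedAddCommGroup H] [InnerProductSpace ℂ H]
variable {π : FTheta θ →* (H →L[ℂ] H)} {ι : Type*} {b : HilbertBasis ι ℂ H}

theorem basis_ne_zero (b : HilbertBasis ι ℂ H) (y : ι) : b y ≠ 0 :=
  b.orthonormal.ne_zero y

theorem basis_eq_of_smul_eq {x y : ι} {c d : ℂ} (hc : c ≠ 0) (h : c • b x = d • b y) : x = y := by
  classical
  by_contra hne
  have h' := congrArg (fun z => ⟪b x, z⟫_ℂ) h
  simp only [inner_smul_right, b.orthonormal.2 hne, inner_self_eq_norm_sq_to_K,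
    b.orthonormal.1] at h'
  simp [hc] at h'

theorem Moves.one (x : ι) : Moves π b 1 x x := ⟨1, by simp, by simp⟩

theorem Moves.mul {w w' : FTheta θ} {x y z : ι} (h : Moves π b w y z) (h' : Moves π b w' x y) :
    Moves π b (w * w') x z := by
  obtain ⟨c, hc, h⟩ := h
  obtain ⟨d, hd, h'⟩ := h'
  exact ⟨d * c, by simp [hc, hd], by
    rw [map_mul, mul_apply_eq_comp, h', map_smul, h, smul_smul]⟩

theorem Moves.target_unique {w : FTheta θ} {x y z : ι} (h : Moves π b w x y)
    (h' : Moves π b w x z) : y = z := by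
  obtain ⟨c, hc, h⟩ := h
  obtain ⟨d, hd, h'⟩ := h'
  exact basis_eq_of_smul_eq (b := b) (norm_ne_zero_iff.1 (by simp [hc])) (h.symm.trans h')

theorem inner_ne_zero_of_moves {w w' : FTheta θ} {x y z : ι} (h : Moves π b w x z)
    (h' : Moves π b w' y z) : ⟪π w (b x), π w' (b y)⟫_ℂ ≠ 0 := by
  obtain ⟨c, hc, h⟩ := h
  obtain ⟨d, hd, h'⟩ := h'
  have hc0 : c ≠ 0 := norm_ne_zero_iff.1 (by simp [hc])
  have hd0 : d ≠ 0 := norm_ne_zero_iff.1 (by simp [hd])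
  simp [h, h', hc0, hd0, inner_self_eq_norm_sq_to_K,
    b.orthonormal.1]

variable [CompleteSpace H]

theorem IsStarRep.inner_map (hπ : IsStarRep π) (w : FTheta θ) (x y : H) :
    ⟪π w x, π w y⟫_ℂ = ⟪x, y⟫_ℂ := inner_map_of_isometry (hπ.isometric w) x y

theorem IsStarRep.norm_map (hπ : IsStarRep π) (w : FTheta θ) (x : H) : ‖π w x‖ = ‖x‖ :=
  (hπ.isometric w).norm_map_of_map_zero (map_zero _) x

theorem IsStarRep.inner_e (hπ : IsStarRep π) {i i' : Fin m} (h : i ≠ i') (x y : H) :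
    ⟪π (e θ i) x, π (e θ i') y⟫_ℂ = 0 :=
  inner_eq_zero_of_sum_eq_one (S := fun i => π (e θ i)) hπ.defectFree.1
    (fun _ => hπ.isometric _) h x y

theorem IsStarRep.inner_f (hπ : IsStarRep π) {j j' : Fin n} (h : j ≠ j') (x y : H) :
    ⟪π (f θ j) x, π (f θ j') y⟫_ℂ = 0 :=
  inner_eq_zero_of_sum_eq_one (S := fun j => π (f θ j)) hπ.defectFree.2
    (fun _ => hπ.isometric _) h x y

/-- Distinct elements of the same degree are mapped to isometries with orthogonal ranges. -/
theorem IsStarRep.inner_of_ne (hπ : IsStarRep π) {w w' : FTheta θ}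
    (hb : blueDegree w = blueDegree w') (hr : redDegree w = redDegree w') (hne : w ≠ w')
    (x y : H) : ⟪π w x, π w' y⟫_ℂ = 0 := by
  induction hd : blueDegree w generalizing w w' with
  | zero =>
    obtain ⟨v, rfl⟩ := exists_eq_fWord hd
    obtain ⟨v', rfl⟩ := exists_eq_fWord (hb.symm.trans hd)
    simp only [redDegree_fWord] at hr
    clear hb hd
    induction v generalizing v' with
    | nil =>
      obtain rfl : v' = [] := by simpa [eq_comm] using hr
      exact absurd rfl hne
    | cons j v ih =>
      cases v' with
      | nil => simp at hr
      | cons j' v' =>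
        simp only [fWord_cons, map_mul, mul_apply_eq_comp]
        by_cases hj : j = j'
        · subst hj
          rw [hπ.inner_map]
          refine ih v' (fun h => hne ?_) (by simpa using hr)
          rw [fWord_cons, fWord_cons, h]
        · exact hπ.inner_f hj _ _
  | succ d ih =>
    obtain ⟨i, w, rfl⟩ := exists_eq_e_mul (w := w) (by omega)
    obtain ⟨i', w', rfl⟩ := exists_eq_e_mul (w := w') (by omega)
    simp only [map_mul, mul_apply_eq_comp]
    simp only [blueDegree_mul, blueDegree_e, redDegree_mul, redDegree_e, zero_add] at hb hr hd
    by_cases hi : i = i'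
    · subst hi
      rw [hπ.inner_map]
      exact ih (by omega) hr (fun h => hne (by rw [h])) (by omega)
    · exact hπ.inner_e hi _ _

theorem IsStarRep.norm_eq_one_of_map (hπ : IsStarRep π) {w : FTheta θ} {x y : ι} {c : ℂ}
    (h : π w (b x) = c • b y) : ‖c‖ = 1 := by
  have h' := congrArg norm h
  rwa [hπ.norm_map, norm_smul, b.orthonormal.1, b.orthonormal.1, mul_one, eq_comm] at h'

theorem IsAtomic.exists_moves (ha : IsAtomic π b) (hπ : IsStarRep π) (w : FTheta θ) (x : ι) :
    ∃ y, Moves π b w x y := by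
  obtain ⟨y, c, -, h⟩ := ha.permutes w x
  exact ⟨y, c, hπ.norm_eq_one_of_map h, h⟩

theorem Moves.source_unique (hπ : IsStarRep π) {w : FTheta θ} {x y z : ι} (h : Moves π b w x z)
    (h' : Moves π b w y z) : x = y := by
  obtain ⟨c, hc, h⟩ := h
  obtain ⟨d, hd, h'⟩ := h'
  have h0 : π w (d • b x) = π w (c • b y) := by
    rw [map_smul, map_smul, h, h', smul_smul, smul_smul, mul_comm]
  exact basis_eq_of_smul_eq (b := b) (norm_ne_zero_iff.1 (by simp [hd]))
    ((hπ.isometric w).injective h0)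

/-- A path whose word is a product passes through an intermediate vertex. -/
theorem Moves.of_mul (ha : IsAtomic π b) (hπ : IsStarRep π) {w w' : FTheta θ} {x z : ι}
    (h : Moves π b (w * w') x z) : ∃ y, Moves π b w' x y ∧ Moves π b w y z := by
  obtain ⟨y, hy⟩ := ha.exists_moves hπ w' x
  obtain ⟨z', hz'⟩ := ha.exists_moves hπ w y
  obtain rfl := h.target_unique (hz'.mul hy)
  exact ⟨y, hy, hz'⟩

/-- Words of the same degree which lead to the same vertex are equal, and start at the same
vertex. -/
theorem Moves.unique (hπ : IsStarRep π) {w w' : FTheta θ} {x y z : ι} (h : Moves π b w x z)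
    (h' : Moves π b w' y z) (hb : blueDegree w = blueDegree w')
    (hr : redDegree w = redDegree w') : w = w' ∧ x = y := by
  obtain rfl : w = w' := by
    by_contra hne
    exact inner_ne_zero_of_moves h h' (hπ.inner_of_ne hb hr hne _ _)
  exact ⟨rfl, h.source_unique hπ h'⟩

theorem moves_of_star_ne_zero (ha : IsAtomic π b) (hπ : IsStarRep π) {w : FTheta θ} {y : ι}
    (h : star (π w) (b y) ≠ 0) : ∃ x, Moves π b w x y := by
  by_contra! hx
  refine h (b.repr.injective ?_)
  ext x
  rw [b.repr_apply_apply, map_zero, ContinuousLinearMap.star_eq_adjoint,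
    ContinuousLinearMap.adjoint_inner_right]
  obtain ⟨z, hz⟩ := ha.exists_moves hπ w x
  have hne : z ≠ y := fun h => hx x (h ▸ hz)
  obtain ⟨c, -, hc⟩ := hz
  rw [hc, inner_smul_left, b.orthonormal.2 hne, mul_zero]
  rfl

theorem IsAtomic.exists_red_pred (ha : IsAtomic π b) (hπ : IsStarRep π) (y : ι) :
    ∃ j x, Moves π b (f θ j) x y := by
  obtain ⟨j, hj⟩ := exists_star_ne_zero (S := fun j => π (f θ j)) hπ.defectFree.2
    (basis_ne_zero b y)
  exact ⟨j, moves_of_star_ne_zero ha hπ hj⟩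

/-- The red graph of a ring by tail representation has no rings.  Red predecessors are unique, so
the infinite tail of a component with a ring would enter the ring and repeat. -/
theorem IsRingByTail.not_moves_fWord (h : IsRingByTail π b) {v : List (Fin n)} (hv : v ≠ [])
    (z : ι) : ¬ Moves π b (fWord θ v) z z := by
  intro hz
  choose jj pred hpred using h.atomic.exists_red_pred h.starRep
  have huniq : ∀ {x y}, RedEdge π b x y → x = pred y := fun {x y} ⟨j, hj⟩ =>
    (hj.unique h.starRep (hpred y) (by simp) (by simp)).2
  have hword : ∀ (v : List (Fin n)) {x y}, Moves π b (fWord θ v) x y → pred^[v.length] y = x := by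
    intro v
    induction v with
    | nil => exact fun {x y} hxy => (hxy.target_unique (Moves.one x) : y = x)
    | cons j v ih =>
      intro x y hxy
      rw [fWord_cons] at hxy
      obtain ⟨z, hxz, hzy⟩ := hxy.of_mul h.atomic h.starRep
      rw [List.length_cons, Function.iterate_succ_apply, ← huniq ⟨j, hzy⟩, ih hxz]
  have hconn : ∀ {x y}, Relation.EqvGen (RedEdge π b) x y →
      ∃ a c, pred^[a] x = pred^[c] y := by
    intro x y hxy
    induction hxy with
    | rel x y hxy => exact ⟨0, 1, huniq hxy⟩
    | refl x => exact ⟨0, 0, rfl⟩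
    | symm x y _ ih => obtain ⟨a, c, hac⟩ := ih; exact ⟨c, a, hac.symm⟩
    | trans x y z _ _ ih ih' =>
      obtain ⟨a, c, hac⟩ := ih
      obtain ⟨a', c', hac'⟩ := ih'
      refine ⟨a' + a, c + c', ?_⟩
      rw [Function.iterate_add_apply, hac, Function.iterate_add_apply, ← hac',
        ← Function.iterate_add_apply, ← Function.iterate_add_apply, add_comm]
  obtain ⟨y, hinj, hcomp, hedge⟩ := h.red_tail z
  have hy : ∀ t, y t = pred^[t] (y 0) := fun t => by
    induction t with
    | zero => rfl
    | succ t ih => rw [Function.iterate_succ_apply', ← ih, ← huniq (hedge t)]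
  obtain ⟨a, c, hac⟩ := hconn (hcomp 0)
  have heq : y (c + v.length) = y c := by
    rw [hy (c + _), hy c, add_comm, Function.iterate_add_apply, ← hac, ← Function.iterate_add_apply,
      add_comm, Function.iterate_add_apply, hword v hz]
  have := hinj heq
  exact hv (List.length_eq_zero_iff.1 (by omega))

end StarRep

/-! ### The vertices of the dilation of a group construction -/

namespace GroupData

section Vertices

variable {m n : ℕ} {θ : Equiv.Perm (Fin m × Fin n)} {G : Type*} [AddCommGroup G] {g₁ g₂ : G}
variable (𝒢 : GroupData θ G g₁ g₂)

theorem e_mul_f_label (g : G) :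
    e θ (𝒢.i (g + g₂)) * f θ (𝒢.j g) = f θ (𝒢.j (g + g₁)) * e θ (𝒢.i g) := by
  rw [e_mul_f, 𝒢.comm]

/-- A pair `(g, w)` stands for the line spanned by the vector `π(w) ξ_g` of a dilation.  As `ξ_g` is
a multiple of `π(e_i) ξ_{g - g₁}`, where `i` is the blue label of `g - g₁`, the same line is given
by the pair `blueBack (g, w)`. -/
def blueBack (y : G × FTheta θ) : G × FTheta θ := (y.1 - g₁, y.2 * e θ (𝒢.i (y.1 - g₁)))

/-- The red analogue of `blueBack`. -/
def redBack (y : G × FTheta θ) : G × FTheta θ := (y.1 - g₂, y.2 * f θ (𝒢.j (y.1 - g₂)))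

theorem blueBack_commute_redBack : Function.Commute 𝒢.blueBack 𝒢.redBack := fun y => by
  obtain ⟨h, hh⟩ : ∃ h, y.1 = h + g₁ + g₂ := ⟨y.1 - g₁ - g₂, by abel⟩
  have h1 : h + g₁ + g₂ - g₁ = h + g₂ := by abel
  simp only [blueBack, redBack, hh, h1, add_sub_cancel_right, mul_assoc, e_mul_f_label]

/-- The result of `a` steps `blueBack` and `b` steps `redBack`. -/
def back (a b : ℕ) (y : G × FTheta θ) : G × FTheta θ := 𝒢.blueBack^[a] (𝒢.redBack^[b] y)

theorem back_back (a b a' b' : ℕ) (y : G × FTheta θ) :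
    𝒢.back a b (𝒢.back a' b' y) = 𝒢.back (a + a') (b + b') y := by
  rw [back, back, back, Function.iterate_add_apply, Function.iterate_add_apply,
    (𝒢.blueBack_commute_redBack.iterate_iterate a' b).eq]

theorem back_comm (a b a' b' : ℕ) (y : G × FTheta θ) :
    𝒢.back a b (𝒢.back a' b' y) = 𝒢.back a' b' (𝒢.back a b y) := by
  rw [back_back, back_back, add_comm a, add_comm b]

theorem back_induction {p : G × FTheta θ → Prop} {y : G × FTheta θ} (h0 : p y)
    (hb : ∀ y, p y → p (𝒢.blueBack y)) (hr : ∀ y, p y → p (𝒢.redBack y)) (a b : ℕ) :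
    p (𝒢.back a b y) := by
  have h1 : p (𝒢.redBack^[b] y) := by
    induction b with
    | zero => exact h0
    | succ b ih => rw [Function.iterate_succ_apply']; exact hr _ ih
  rw [back]
  induction a with
  | zero => exact h1
  | succ a ih => rw [Function.iterate_succ_apply']; exact hb _ ih

theorem back_succ_left (a b : ℕ) (y : G × FTheta θ) :
    𝒢.back (a + 1) b y = 𝒢.blueBack (𝒢.back a b y) := by
  rw [back, back, Function.iterate_succ_apply']

theorem back_zero_succ (b : ℕ) (y : G × FTheta θ) :
    𝒢.back 0 (b + 1) y = 𝒢.redBack (𝒢.back 0 b y) := by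
  simp [back, Function.iterate_succ_apply']

theorem back_spec (a b : ℕ) (y : G × FTheta θ) :
    (𝒢.back a b y).1 = y.1 - a • g₁ - b • g₂ ∧
      blueDegree (𝒢.back a b y).2 = blueDegree y.2 + a ∧
      redDegree (𝒢.back a b y).2 = redDegree y.2 + b := by
  induction a with
  | zero =>
    induction b with
    | zero => simp [back]
    | succ b ih =>
      rw [back_zero_succ, redBack]
      refine ⟨?_, by simp [ih], by simp [ih, add_assoc]⟩
      simp only [ih, succ_nsmul]
      abel
  | succ a ih =>
    rw [back_succ_left, blueBack]
    refine ⟨?_, by simp [ih, add_assoc], by simp [ih]⟩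
    simp only [ih, succ_nsmul]
    abel

theorem back_mul (w : FTheta θ) (a b : ℕ) (y : G × FTheta θ) :
    𝒢.back a b (y.1, w * y.2) = ((𝒢.back a b y).1, w * (𝒢.back a b y).2) := by
  induction a with
  | zero =>
    induction b with
    | zero => simp [back]
    | succ b ih => rw [back_zero_succ, back_zero_succ, ih, redBack, redBack, mul_assoc]
  | succ a ih => rw [back_succ_left, back_succ_left, ih, blueBack, blueBack, mul_assoc]

/-- Two pairs give the same line if steps backwards lead from them to the same pair. -/
def vertexSetoid : Setoid (G × FTheta θ) where
  r y y' := ∃ a b a' b', 𝒢.back a b y = 𝒢.back a' b' y'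
  iseqv :=
    { refl := fun _ => ⟨0, 0, 0, 0, rfl⟩
      symm := fun ⟨a, b, a', b', h⟩ => ⟨a', b', a, b, h.symm⟩
      trans := fun {x y z} ⟨a, b, a', b', h⟩ ⟨c, d, c', d', h'⟩ =>
        ⟨c + a, d + b, a' + c', b' + d', by
          rw [← back_back, h, back_comm, h', back_back]⟩ }

/-- The vertices of the graph of the minimal `*`-dilation of a group construction. -/
def Vertex : Type _ := Quotient 𝒢.vertexSetoid

/-- The vertex given by a pair `(g, w)`. -/
def mkVertex (y : G × FTheta θ) : 𝒢.Vertex := Quotient.mk 𝒢.vertexSetoid y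

theorem mkVertex_eq_iff {y y' : G × FTheta θ} : 𝒢.mkVertex y = 𝒢.mkVertex y' ↔
    ∃ a b a' b', 𝒢.back a b y = 𝒢.back a' b' y' :=
  Quotient.eq (r := 𝒢.vertexSetoid)

theorem mkVertex_back (a b : ℕ) (y : G × FTheta θ) : 𝒢.mkVertex (𝒢.back a b y) = 𝒢.mkVertex y :=
  𝒢.mkVertex_eq_iff.2 ⟨0, 0, a, b, rfl⟩

theorem mkVertex_blueBack (y : G × FTheta θ) : 𝒢.mkVertex (𝒢.blueBack y) = 𝒢.mkVertex y :=
  𝒢.mkVertex_back 1 0 y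

theorem mkVertex_redBack (y : G × FTheta θ) : 𝒢.mkVertex (𝒢.redBack y) = 𝒢.mkVertex y :=
  𝒢.mkVertex_back 0 1 y

instance : MulAction (FTheta θ) 𝒢.Vertex where
  smul w := Quotient.map (sa := 𝒢.vertexSetoid) (sb := 𝒢.vertexSetoid)
    (fun y => (y.1, w * y.2)) (fun y y' ⟨a, b, a', b', h⟩ =>
      ⟨a, b, a', b', by rw [back_mul, back_mul, h]⟩)
  one_smul := by
    rintro ⟨y⟩
    exact congrArg (Quotient.mk 𝒢.vertexSetoid) (Prod.ext rfl (one_mul _))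
  mul_smul := by
    rintro w w' ⟨y⟩
    exact congrArg (Quotient.mk 𝒢.vertexSetoid) (Prod.ext rfl (mul_assoc _ _ _))

theorem smul_mkVertex (w : FTheta θ) (y : G × FTheta θ) :
    w • 𝒢.mkVertex y = 𝒢.mkVertex (y.1, w * y.2) := rfl

/-- The vertex of the basis vector `ξ_g` of `ℓ²(G)`. -/
def vertex (g : G) : 𝒢.Vertex := 𝒢.mkVertex (g, 1)

theorem mkVertex_eq_smul (y : G × FTheta θ) : 𝒢.mkVertex y = y.2 • 𝒢.vertex y.1 := by
  rw [vertex, smul_mkVertex, mul_one]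

theorem exists_eq_smul_vertex (z : 𝒢.Vertex) : ∃ (w : FTheta θ) (g : G), z = w • 𝒢.vertex g := by
  obtain ⟨y, rfl⟩ := Quotient.exists_rep z
  exact ⟨y.2, y.1, 𝒢.mkVertex_eq_smul y⟩

theorem e_smul_vertex (g : G) : e θ (𝒢.i g) • 𝒢.vertex g = 𝒢.vertex (g + g₁) := by
  rw [vertex, vertex, ← mkVertex_blueBack _ (g + g₁, 1), blueBack, smul_mkVertex]
  simp

theorem f_smul_vertex (g : G) : f θ (𝒢.j g) • 𝒢.vertex g = 𝒢.vertex (g + g₂) := by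
  rw [vertex, vertex, ← mkVertex_redBack _ (g + g₂, 1), redBack, smul_mkVertex]
  simp

/-- If paths with the words `w` and `w'` lead from `z` and `z'` to the same vertex, then `z` and
`z'` are reached from a common vertex of the group construction in such a way that the two composed
words are equal. -/
theorem smul_eq_smul {w w' : FTheta θ} {z z' : 𝒢.Vertex} (h : w • z = w' • z') :
    ∃ x x' : FTheta θ, ∃ g g' : G, z = x • 𝒢.vertex g ∧ z' = x' • 𝒢.vertex g' ∧
      g = g' ∧ w * x = w' * x' := by
  obtain ⟨y, rfl⟩ := Quotient.exists_rep z
  obtain ⟨y', rfl⟩ := Quotient.exists_rep z'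
  obtain ⟨a, b, a', b', h⟩ := 𝒢.mkVertex_eq_iff.1 h
  rw [back_mul, back_mul, Prod.mk.injEq] at h
  refine ⟨(𝒢.back a b y).2, (𝒢.back a' b' y').2, _, _, ?_, ?_, h.1, h.2⟩
  · rw [← mkVertex_eq_smul, mkVertex_back]; rfl
  · rw [← mkVertex_eq_smul, mkVertex_back]; rfl

theorem smul_left_injective_vertex (w : FTheta θ) {z z' : 𝒢.Vertex} (h : w • z = w • z') :
    z = z' := by
  obtain ⟨x, x', g, g', rfl, rfl, rfl, h'⟩ := 𝒢.smul_eq_smul h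
  rw [mul_left_cancel_fTheta w h']

theorem e_smul_inj {i i' : Fin m} {z z' : 𝒢.Vertex} (h : e θ i • z = e θ i' • z') : i = i' := by
  obtain ⟨x, x', g, g', rfl, rfl, rfl, h'⟩ := 𝒢.smul_eq_smul h
  exact (e_mul_inj h').1

theorem f_smul_inj {j j' : Fin n} {z z' : 𝒢.Vertex} (h : f θ j • z = f θ j' • z') : j = j' := by
  obtain ⟨x, x', g, g', rfl, rfl, rfl, h'⟩ := 𝒢.smul_eq_smul h
  exact (f_mul_inj h').1

theorem exists_eq_e_smul (z : 𝒢.Vertex) : ∃ (i : Fin m) (z' : 𝒢.Vertex), z = e θ i • z' := by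
  obtain ⟨y, rfl⟩ := Quotient.exists_rep z
  obtain ⟨i, w, h⟩ := exists_mul_e_eq y.2 (𝒢.i (y.1 - g₁))
  refine ⟨i, 𝒢.mkVertex (y.1 - g₁, w), ?_⟩
  rw [smul_mkVertex, ← h]
  exact (𝒢.mkVertex_blueBack y).symm

theorem exists_eq_f_smul (z : 𝒢.Vertex) : ∃ (j : Fin n) (z' : 𝒢.Vertex), z = f θ j • z' := by
  obtain ⟨y, rfl⟩ := Quotient.exists_rep z
  obtain ⟨j, w, h⟩ := exists_mul_f_eq y.2 (𝒢.j (y.1 - g₂))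
  refine ⟨j, 𝒢.mkVertex (y.1 - g₂, w), ?_⟩
  rw [smul_mkVertex, ← h]
  exact (𝒢.mkVertex_redBack y).symm

/-- If a path leads from a vertex to itself, then its degrees give a relation in `G`. -/
theorem smul_eq_self {w : FTheta θ} {z : 𝒢.Vertex} (h : w • z = z) :
    ∃ a b : ℕ, (blueDegree w + a) • g₁ + (redDegree w + b) • g₂ = a • g₁ + b • g₂ := by
  obtain ⟨y, rfl⟩ := Quotient.exists_rep z
  obtain ⟨a, b, a', b', h⟩ := 𝒢.mkVertex_eq_iff.1 h
  obtain ⟨h1, h2, h3⟩ := 𝒢.back_spec a b (y.1, w * y.2)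
  obtain ⟨h1', h2', h3'⟩ := 𝒢.back_spec a' b' y
  rw [h] at h1 h2 h3
  rw [h1] at h1'
  rw [h2, blueDegree_mul] at h2'
  rw [h3, redDegree_mul] at h3'
  obtain rfl : a' = blueDegree w + a := by omega
  obtain rfl : b' = redDegree w + b := by omega
  refine ⟨a, b, ?_⟩
  dsimp only at h1'
  rw [sub_sub, sub_sub] at h1'
  exact (sub_right_inj.1 h1').symm

theorem vertex_injective : Function.Injective 𝒢.vertex := fun g g' h => by
  obtain ⟨a, b, a', b', h⟩ := 𝒢.mkVertex_eq_iff.1 h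
  obtain ⟨h1, h2, h3⟩ := 𝒢.back_spec a b (g, 1)
  obtain ⟨h1', h2', h3'⟩ := 𝒢.back_spec a' b' (g', 1)
  rw [h] at h1 h2 h3
  obtain rfl : a = a' := by rw [h2] at h2'; simpa using h2'
  obtain rfl : b = b' := by rw [h3] at h3'; simpa using h3'
  simpa [h1] using h1'

open Classical in
/-- A pair giving the vertex `z`; it is `(g, 1)` if `z` is the vertex of `ξ_g`. -/
def pair (z : 𝒢.Vertex) : G × FTheta θ :=
  if h : ∃ g, 𝒢.vertex g = z then (h.choose, 1) else Quotient.out (s := 𝒢.vertexSetoid) z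

theorem pair_vertex (g : G) : 𝒢.pair (𝒢.vertex g) = (g, 1) := by
  have h : ∃ g', 𝒢.vertex g' = 𝒢.vertex g := ⟨g, rfl⟩
  rw [pair, dif_pos h, 𝒢.vertex_injective h.choose_spec]

theorem mkVertex_pair (z : 𝒢.Vertex) : 𝒢.mkVertex (𝒢.pair z) = z := by
  by_cases h : ∃ g, 𝒢.vertex g = z
  · obtain ⟨g, rfl⟩ := h
    rw [pair_vertex]
    rfl
  · rw [pair, dif_neg h]
    exact Quotient.out_eq (s := 𝒢.vertexSetoid) z

end Vertices

end GroupData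

/-! ### The basis vectors of a minimal dilation -/

namespace GroupData

section StandardBasis

variable {G : Type*} [DecidableEq G]

theorem inner_single_single (g g' : G) :
    ⟪(lp.single 2 g (1 : ℂ) : EllTwo G), lp.single 2 g' (1 : ℂ)⟫_ℂ = if g = g' then 1 else 0 := by
  rw [lp.inner_single_left, lp.single_apply, Pi.single_apply]
  split_ifs <;> simp

theorem norm_single_one (g : G) : ‖(lp.single 2 g (1 : ℂ) : EllTwo G)‖ = 1 := by
  rw [lp.norm_single (by norm_num), norm_one]

theorem dense_span_single :
    (Submodule.span ℂ (Set.range fun g : G =>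
      (lp.single 2 g (1 : ℂ) : EllTwo G))).topologicalClosure = ⊤ := by
  rw [← (HilbertBasis.ofRepr (LinearIsometryEquiv.refl ℂ (EllTwo G))).dense_span]
  congr 3
  funext g
  rw [← HilbertBasis.repr_symm_single]
  rfl

theorem weightedShift_single [AddCommGroup G] (a : G) (φ : G → ℂ) (hφ : ∀ g, ‖φ g‖ ≤ 1) (g : G) :
    weightedShift a φ hφ (lp.single 2 g (1 : ℂ)) = φ g • lp.single 2 (g + a) (1 : ℂ) := by
  ext h
  rw [weightedShift_apply, lp.coeFn_smul, Pi.smul_apply, lp.single_apply, lp.single_apply]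
  by_cases hh : h = g + a
  · subst hh; simp
  · have : h - a ≠ g := fun h' => hh (by rw [← h', sub_add_cancel])
    simp [hh, this]

variable {m n : ℕ} {θ : Equiv.Perm (Fin m × Fin n)}
variable {H : Type*} [NormedAddCommGroup H] [InnerProductSpace ℂ H]
variable {π : FTheta θ →* (H →L[ℂ] H)} {V : EllTwo G →ₗᵢ[ℂ] H}

theorem eq_smul_of_inner_eq {x y : H} {c : ℂ} (hx : ‖x‖ = 1) (hy : ‖y‖ = 1) (hc : ‖c‖ = 1)
    (h : (⟪y, x⟫_ℂ : ℂ) = c) : x = c • y := by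
  have hcy : ‖c • y‖ = 1 := by rw [norm_smul, hc, hy, one_mul]
  refine ((inner_eq_one_iff_of_norm_eq_one (𝕜 := ℂ) hcy hx).1 ?_).symm
  rw [inner_smul_left, h, ← Complex.normSq_eq_conj_mul_self, Complex.normSq_eq_norm_sq, hc]
  norm_num

variable (π V) in
/-- The vector `π(w) ξ_g`, which spans the line given by the pair `(g, w)`. -/
def atom (y : G × FTheta θ) : H := π y.2 (V (lp.single 2 y.1 1))

theorem map_atom (w : FTheta θ) (y : G × FTheta θ) :
    π w (atom π V y) = atom π V (y.1, w * y.2) := by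
  rw [atom, atom, map_mul, mul_apply_eq_comp]

variable (V) in
theorem adjoint_apply [CompleteSpace H] (y : H) (g : G) :
    (V.toContinuousLinearMap.adjoint y : EllTwo G) g = ⟪V (lp.single 2 g 1), y⟫_ℂ := by
  have := ContinuousLinearMap.adjoint_inner_right V.toContinuousLinearMap (lp.single 2 g 1) y
  rw [lp.inner_single_left] at this
  simpa using this

end StandardBasis

section Dilations

variable {m n : ℕ} {θ : Equiv.Perm (Fin m × Fin n)} {G : Type*} [AddCommGroup G] {g₁ g₂ : G}
variable {𝒢 : GroupData θ G g₁ g₂}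

/-- Steps backwards change the vectors by unimodular scalars. -/
theorem exists_smul_back {M : Type*} [AddCommGroup M] [Module ℂ M] {A : G × FTheta θ → M}
    (hb : ∀ y, A (𝒢.blueBack y) = (𝒢.α (y.1 - g₁) : ℂ) • A y)
    (hr : ∀ y, A (𝒢.redBack y) = (𝒢.β (y.1 - g₂) : ℂ) • A y) (a b : ℕ) (y : G × FTheta θ) :
    ∃ c : Circle, A (𝒢.back a b y) = (c : ℂ) • A y := by
  refine 𝒢.back_induction (p := fun y' => ∃ c : Circle, A y' = (c : ℂ) • A y)
    ⟨1, by simp⟩ ?_ ?_ a b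
  · rintro y' ⟨c, hc⟩
    exact ⟨𝒢.α (y'.1 - g₁) * c, by rw [hb, hc, smul_smul, Circle.coe_mul]⟩
  · rintro y' ⟨c, hc⟩
    exact ⟨𝒢.β (y'.1 - g₂) * c, by rw [hr, hc, smul_smul, Circle.coe_mul]⟩

/-- Two pairs which give the same vertex have proportional vectors.  The factor depends only on the
group construction; this is expressed by allowing vector valued functions `A`, in particular pairs
of functions. -/
theorem exists_smul_eq_of_mkVertex_eq {M : Type*} [AddCommGroup M] [Module ℂ M]
    {A : G × FTheta θ → M}
    (hb : ∀ y, A (𝒢.blueBack y) = (𝒢.α (y.1 - g₁) : ℂ) • A y)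
    (hr : ∀ y, A (𝒢.redBack y) = (𝒢.β (y.1 - g₂) : ℂ) • A y) {y y' : G × FTheta θ}
    (h : 𝒢.mkVertex y = 𝒢.mkVertex y') : ∃ c : Circle, A y = (c : ℂ) • A y' := by
  obtain ⟨a, b, a', b', h⟩ := 𝒢.mkVertex_eq_iff.1 h
  obtain ⟨c, hc⟩ := exists_smul_back hb hr a b y
  obtain ⟨c', hc'⟩ := exists_smul_back hb hr a' b' y'
  refine ⟨c⁻¹ * c', ?_⟩
  rw [Circle.coe_mul, ← smul_smul, ← hc', ← h, hc, smul_smul, ← Circle.coe_mul]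
  simp

variable [DecidableEq G]
variable {H : Type*} [NormedAddCommGroup H] [InnerProductSpace ℂ H] [CompleteSpace H]
variable {π : FTheta θ →* (H →L[ℂ] H)} {V : EllTwo G →ₗᵢ[ℂ] H}

variable (𝒢 π V) in
/-- A `*`-representation in which the images of the vectors `ξ_g` are permuted as in the group
construction, and generate the whole space.  These are the minimal `*`-dilations of the group
construction. -/
structure IsCarrier : Prop where
  starRep : IsStarRep π
  map_e : ∀ g, π (e θ (𝒢.i g)) (V (lp.single 2 g 1)) = (𝒢.α g : ℂ) • V (lp.single 2 (g + g₁) 1)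
  map_f : ∀ g, π (f θ (𝒢.j g)) (V (lp.single 2 g 1)) = (𝒢.β g : ℂ) • V (lp.single 2 (g + g₂) 1)
  dense : (Submodule.span ℂ (Set.range (atom π V))).topologicalClosure = ⊤

/-- Minimal `*`-dilations contain the group construction as a corner on which the paths of the group
construction act exactly: `π(e_i) ξ_g` and `ξ_{g + g₁}` are unit vectors with an inner product of
modulus one. -/
theorem isCarrier_of_isMinimalStarDilation (h : IsMinimalStarDilation 𝒢.rep π V) :
    IsCarrier 𝒢 π V where
  starRep := h.starRep
  map_e g := by
    refine eq_smul_of_inner_eq ?_ ?_ (Circle.norm_coe _) ?_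
    · rw [h.starRep.norm_map, V.norm_map, norm_single_one]
    · rw [V.norm_map, norm_single_one]
    · rw [h.dilation, rep_e, E, weightedShift_single, inner_smul_right, inner_single_single]
      simp
  map_f g := by
    refine eq_smul_of_inner_eq ?_ ?_ (Circle.norm_coe _) ?_
    · rw [h.starRep.norm_map, V.norm_map, norm_single_one]
    · rw [V.norm_map, norm_single_one]
    · rw [h.dilation, rep_f, F, weightedShift_single, inner_smul_right, inner_single_single]
      simp
  dense := by
    rw [eq_top_iff, ← h.minimal]
    refine Submodule.topologicalClosure_minimal _ ?_ (Submodule.isClosed_topologicalClosure _)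
    rw [Submodule.span_le]
    rintro _ ⟨w, x, rfl⟩
    -- `minimal` speaks of `π(w) V x` for all `x`; by continuity the vectors `ξ_g` suffice.
    set M := (Submodule.span ℂ (Set.range (atom π V))).topologicalClosure
    let T : EllTwo G →L[ℂ] H := (π w).comp V.toContinuousLinearMap
    have hle : (Submodule.span ℂ (Set.range fun g : G =>
        (lp.single 2 g (1 : ℂ) : EllTwo G))).topologicalClosure ≤ M.comap T.toLinearMap := by
      refine Submodule.topologicalClosure_minimal _ ?_
        ((Submodule.isClosed_topologicalClosure _).preimage T.continuous)
      rw [Submodule.span_le]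
      rintro _ ⟨g, rfl⟩
      exact Submodule.le_topologicalClosure _ (Submodule.subset_span ⟨(g, w), rfl⟩)
    rw [dense_span_single] at hle
    exact hle (Submodule.mem_top (x := x))

theorem IsCarrier.adjoint_e (h : IsCarrier 𝒢 π V) (i : Fin m) (y : H) :
    V.toContinuousLinearMap.adjoint (π (e θ i) y) =
      𝒢.rep (e θ i) (V.toContinuousLinearMap.adjoint y) := by
  ext g'
  obtain ⟨g, rfl⟩ : ∃ g, g' = g + g₁ := ⟨g' - g₁, by abel⟩
  rw [rep_e, E, weightedShift_apply, add_sub_cancel_right, adjoint_apply, adjoint_apply]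
  have hV : (V (lp.single 2 (g + g₁) 1)) =
      (starRingEnd ℂ (𝒢.α g : ℂ)) • π (e θ (𝒢.i g)) (V (lp.single 2 g 1)) := by
    rw [h.map_e, smul_smul, ← Complex.normSq_eq_conj_mul_self, Circle.normSq_coe]
    simp
  rw [hV, inner_smul_left, Complex.conj_conj]
  split_ifs with hi
  · rw [hi, h.starRep.inner_map]
  · rw [h.starRep.inner_e (Ne.symm hi), mul_zero, zero_mul]

theorem IsCarrier.adjoint_f (h : IsCarrier 𝒢 π V) (j : Fin n) (y : H) :
    V.toContinuousLinearMap.adjoint (π (f θ j) y) =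
      𝒢.rep (f θ j) (V.toContinuousLinearMap.adjoint y) := by
  ext g'
  obtain ⟨g, rfl⟩ : ∃ g, g' = g + g₂ := ⟨g' - g₂, by abel⟩
  rw [rep_f, F, weightedShift_apply, add_sub_cancel_right, adjoint_apply, adjoint_apply]
  have hV : (V (lp.single 2 (g + g₂) 1)) =
      (starRingEnd ℂ (𝒢.β g : ℂ)) • π (f θ (𝒢.j g)) (V (lp.single 2 g 1)) := by
    rw [h.map_f, smul_smul, ← Complex.normSq_eq_conj_mul_self, Circle.normSq_coe]
    simp
  rw [hV, inner_smul_left, Complex.conj_conj]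
  split_ifs with hj
  · rw [hj, h.starRep.inner_map]
  · rw [h.starRep.inner_f (Ne.symm hj), mul_zero, zero_mul]

/-- The range of `V` is co-invariant, so that compressing `π` to it is multiplicative. -/
theorem IsCarrier.adjoint_map (h : IsCarrier 𝒢 π V) (w : FTheta θ) (y : H) :
    V.toContinuousLinearMap.adjoint (π w y) =
      𝒢.rep w (V.toContinuousLinearMap.adjoint y) := by
  induction w using FTheta.induction with
  | one => simp
  | e_mul i w ih => rw [map_mul, map_mul, mul_apply_eq_comp, mul_apply_eq_comp, h.adjoint_e, ih]
  | f_mul j w ih => rw [map_mul, map_mul, mul_apply_eq_comp, mul_apply_eq_comp, h.adjoint_f, ih]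

theorem IsCarrier.isMinimalStarDilation (h : IsCarrier 𝒢 π V) :
    IsMinimalStarDilation 𝒢.rep π V where
  starRep := h.starRep
  dilation w x y := by
    have h1 : V.toContinuousLinearMap.adjoint (V x) = x := by
      refine ext_inner_left ℂ fun z => ?_
      rw [ContinuousLinearMap.adjoint_inner_right]
      exact V.inner_map_map z x
    have h2 := ContinuousLinearMap.adjoint_inner_right V.toContinuousLinearMap y (π w (V x))
    rw [h.adjoint_map, h1] at h2
    exact h2.symm
  minimal := by
    rw [eq_top_iff, ← h.dense]
    refine Submodule.topologicalClosure_mono (Submodule.span_mono ?_)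
    rintro _ ⟨y, rfl⟩
    exact ⟨y.2, _, rfl⟩

theorem IsCarrier.atom_blueBack (h : IsCarrier 𝒢 π V) (y : G × FTheta θ) :
    atom π V (𝒢.blueBack y) = (𝒢.α (y.1 - g₁) : ℂ) • atom π V y := by
  rw [atom, blueBack, map_mul, mul_apply_eq_comp, h.map_e, map_smul, sub_add_cancel, atom]

theorem IsCarrier.atom_redBack (h : IsCarrier 𝒢 π V) (y : G × FTheta θ) :
    atom π V (𝒢.redBack y) = (𝒢.β (y.1 - g₂) : ℂ) • atom π V y := by
  rw [atom, redBack, map_mul, mul_apply_eq_comp, h.map_f, map_smul, sub_add_cancel, atom]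

theorem IsCarrier.norm_atom (h : IsCarrier 𝒢 π V) (y : G × FTheta θ) : ‖atom π V y‖ = 1 := by
  rw [atom, h.starRep.norm_map, V.norm_map, norm_single_one]

/-- Lines given by different vertices are orthogonal: after steps backwards the words have the same
degree. -/
theorem IsCarrier.inner_atom (h : IsCarrier 𝒢 π V) {y y' : G × FTheta θ}
    (hne : 𝒢.mkVertex y ≠ 𝒢.mkVertex y') : ⟪atom π V y, atom π V y'⟫_ℂ = 0 := by
  set z := 𝒢.back (blueDegree y'.2) (redDegree y'.2) y with hz
  set z' := 𝒢.back (blueDegree y.2) (redDegree y.2) y' with hz'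
  obtain ⟨-, h2, h3⟩ := 𝒢.back_spec (blueDegree y'.2) (redDegree y'.2) y
  obtain ⟨-, h2', h3'⟩ := 𝒢.back_spec (blueDegree y.2) (redDegree y.2) y'
  obtain ⟨c, hc⟩ := exists_smul_eq_of_mkVertex_eq h.atom_blueBack h.atom_redBack
    (𝒢.mkVertex_back (blueDegree y'.2) (redDegree y'.2) y).symm
  obtain ⟨c', hc'⟩ := exists_smul_eq_of_mkVertex_eq h.atom_blueBack h.atom_redBack
    (𝒢.mkVertex_back (blueDegree y.2) (redDegree y.2) y').symm
  have hzz : z ≠ z' := fun hzz => hne (by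
    rw [← 𝒢.mkVertex_back (blueDegree y'.2) (redDegree y'.2) y, ← hz, hzz, hz', mkVertex_back])
  rw [hc, hc', inner_smul_left, inner_smul_right, ← hz, ← hz']
  suffices ⟪atom π V z, atom π V z'⟫_ℂ = 0 by rw [this, mul_zero, mul_zero]
  rw [atom, atom]
  by_cases hw : z.2 = z'.2
  · have hg : z.1 ≠ z'.1 := fun hg => hzz (Prod.ext hg hw)
    rw [hw, h.starRep.inner_map, V.inner_map_map, inner_single_single, if_neg hg]
  · exact h.starRep.inner_of_ne
      (by rw [hz, hz', h2, h2', add_comm]) (by rw [hz, hz', h3, h3', add_comm]) hw _ _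

theorem IsCarrier.orthonormal (h : IsCarrier 𝒢 π V) :
    Orthonormal ℂ (fun z => atom π V (𝒢.pair z)) :=
  ⟨fun _ => h.norm_atom _, fun z z' hne => h.inner_atom (by
    rwa [mkVertex_pair, mkVertex_pair])⟩

theorem IsCarrier.dense_pair (h : IsCarrier 𝒢 π V) :
    ⊤ ≤ (Submodule.span ℂ (Set.range fun z => atom π V (𝒢.pair z))).topologicalClosure := by
  rw [← h.dense]
  refine Submodule.topologicalClosure_mono (Submodule.span_le.2 ?_)
  rintro _ ⟨y, rfl⟩
  obtain ⟨c, hc⟩ := exists_smul_eq_of_mkVertex_eq h.atom_blueBack h.atom_redBack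
    (𝒢.mkVertex_pair (𝒢.mkVertex y)).symm
  rw [hc]
  exact Submodule.smul_mem _ _ (Submodule.subset_span ⟨_, rfl⟩)

/-- The orthonormal basis of a minimal dilation, indexed by the vertices. -/
def IsCarrier.basis (h : IsCarrier 𝒢 π V) : HilbertBasis 𝒢.Vertex ℂ H :=
  HilbertBasis.mk h.orthonormal h.dense_pair

theorem IsCarrier.basis_apply (h : IsCarrier 𝒢 π V) (z : 𝒢.Vertex) :
    h.basis z = atom π V (𝒢.pair z) := by
  rw [IsCarrier.basis, HilbertBasis.coe_mk]

theorem IsCarrier.basis_vertex (h : IsCarrier 𝒢 π V) (g : G) :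
    h.basis (𝒢.vertex g) = V (lp.single 2 g 1) := by
  rw [basis_apply, pair_vertex, atom, map_one]
  rfl

theorem IsCarrier.moves (h : IsCarrier 𝒢 π V) (w : FTheta θ) (z : 𝒢.Vertex) :
    Moves π h.basis w z (w • z) := by
  obtain ⟨c, hc⟩ := exists_smul_eq_of_mkVertex_eq h.atom_blueBack h.atom_redBack
    (y := ((𝒢.pair z).1, w * (𝒢.pair z).2)) (y' := 𝒢.pair (w • z))
    (by rw [← smul_mkVertex, mkVertex_pair, mkVertex_pair])
  exact ⟨c, Circle.norm_coe _, by rw [basis_apply, basis_apply, map_atom, hc]⟩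

theorem IsCarrier.moves_iff (h : IsCarrier 𝒢 π V) (w : FTheta θ) (z z' : 𝒢.Vertex) :
    Moves π h.basis w z z' ↔ w • z = z' :=
  ⟨fun h' => (h.moves w z).target_unique h', fun h' => h' ▸ h.moves w z⟩

/-- The minimal `*`-dilation of a group construction is unique. -/
theorem IsCarrier.unitarilyEquivalent {H' : Type*} [NormedAddCommGroup H'] [InnerProductSpace ℂ H']
    [CompleteSpace H'] {π' : FTheta θ →* (H' →L[ℂ] H')} {V' : EllTwo G →ₗᵢ[ℂ] H'}
    (h : IsCarrier 𝒢 π V) (h' : IsCarrier 𝒢 π' V') : UnitarilyEquivalent π π' := by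
  classical
  let U := h.basis.repr.trans h'.basis.repr.symm
  have hU : ∀ z, U (h.basis z) = h'.basis z := fun z => by
    rw [LinearIsometryEquiv.trans_apply, HilbertBasis.repr_self, HilbertBasis.repr_symm_single]
  refine ⟨U, fun w x => ?_⟩
  -- The pair of the two families of vectors shows that both have the same factor.
  have hpair : ∀ y y', 𝒢.mkVertex y = 𝒢.mkVertex y' → ∃ c : ℂ,
      atom π V y = c • atom π V y' ∧ atom π' V' y = c • atom π' V' y' := fun y y' hy => by
    obtain ⟨c, hc⟩ := exists_smul_eq_of_mkVertex_eq (A := fun y => (atom π V y, atom π' V' y))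
      (fun y => Prod.ext (h.atom_blueBack y) (h'.atom_blueBack y))
      (fun y => Prod.ext (h.atom_redBack y) (h'.atom_redBack y)) hy
    exact ⟨c, congrArg Prod.fst hc, congrArg Prod.snd hc⟩
  have key : (U.toContinuousLinearEquiv.toContinuousLinearMap.comp (π w)) =
      (π' w).comp U.toContinuousLinearEquiv.toContinuousLinearMap := by
    refine ContinuousLinearMap.ext_on (s := Set.range h.basis)
      (Submodule.dense_iff_topologicalClosure_eq_top.2 h.basis.dense_span) ?_
    rintro _ ⟨z, rfl⟩
    obtain ⟨c, hc, hc'⟩ := hpair ((𝒢.pair z).1, w * (𝒢.pair z).2) (𝒢.pair (w • z))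
      (by rw [← smul_mkVertex, mkVertex_pair, mkVertex_pair])
    change U (π w (h.basis z)) = π' w (U (h.basis z))
    rw [hU, h.basis_apply, h'.basis_apply, map_atom, map_atom, hc, hc', map_smul, ← h.basis_apply,
      ← h'.basis_apply, hU]
  exact DFunLike.congr_fun key x

end Dilations

end GroupData

/-! ### The graph of a minimal dilation -/

namespace GroupData

section Graph

variable {m n : ℕ} {θ : Equiv.Perm (Fin m × Fin n)} {G : Type*} [AddCommGroup G] {g₁ g₂ : G}
variable {𝒢 : GroupData θ G g₁ g₂}

variable (𝒢) in
theorem exists_eWord_smul_vertex (l : ℕ) (g : G) :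
    ∃ u : List (Fin m), u.length = l ∧ eWord θ u • 𝒢.vertex g = 𝒢.vertex (g + l • g₁) := by
  induction l with
  | zero => exact ⟨[], rfl, by simp [eWord]⟩
  | succ l ih =>
    obtain ⟨u, hl, hu⟩ := ih
    refine ⟨𝒢.i (g + l • g₁) :: u, by simp [hl], ?_⟩
    rw [eWord_cons, mul_smul, hu, e_smul_vertex, succ_nsmul, add_assoc]

/-- If `g₁` has finite order, each blue component contains a ring: it contains a vertex
`f_v ξ_g`, and the vertices of this form, for a given length of `v`, with `g` in a coset of the
finite group generated by `g₁`, form a finite set which is invariant under steps backwards. -/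
theorem exists_blue_ring {k : ℕ} (hk : 0 < k) (hg : k • g₁ = 0) (z : 𝒢.Vertex) :
    ∃ (u u' u'' : List (Fin m)) (y z' : 𝒢.Vertex), u ≠ [] ∧ eWord θ u • y = y ∧
      z = eWord θ u' • z' ∧ z' = eWord θ u'' • y := by
  obtain ⟨w, g, rfl⟩ := 𝒢.exists_eq_smul_vertex z
  obtain ⟨u', v, rfl⟩ := exists_eq_eWord_mul_fWord w
  let T := List.Vector (Fin n) v.length × ZMod k
  have : NeZero k := ⟨hk.ne'⟩
  let q : T → 𝒢.Vertex := fun t => fWord θ t.1.toList • 𝒢.vertex (g + t.2.val • g₁)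
  have hmod : ∀ a : ℕ, (a % k) • g₁ = a • g₁ := fun a => by
    conv_rhs =>
      rw [← Nat.mod_add_div a k, add_nsmul, mul_comm, mul_nsmul', hg, smul_zero, add_zero]
  have hstep : ∀ t : T, ∃ t' : T, ∃ i, q t = e θ i • q t' := fun ⟨v', s⟩ => by
    obtain ⟨i, v'', hl, hv''⟩ := exists_fWord_mul_e (θ := θ) v'.toList
      (𝒢.i (g + (s - 1).val • g₁))
    refine ⟨(⟨v'', by rw [hl, v'.toList_length]⟩, s - 1), i, ?_⟩
    have hs : g + s.val • g₁ = g + (s - 1).val • g₁ + g₁ := by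
      rw [add_assoc, ← succ_nsmul, ← hmod ((s - 1).val + 1)]
      conv_lhs =>
        rw [← sub_add_cancel s 1, ZMod.val_add, ZMod.val_one_eq_one_mod, Nat.add_mod_mod]
    change fWord θ v'.toList • 𝒢.vertex (g + s.val • g₁) =
      e θ i • fWord θ v'' • 𝒢.vertex (g + (s - 1).val • g₁)
    rw [hs, ← e_smul_vertex, ← mul_smul, hv'', mul_smul]
  choose next lab hnext using hstep
  have hiter : ∀ (l : ℕ) (t : T), ∃ u : List (Fin m), u.length = l ∧
      q t = eWord θ u • q (next^[l] t) := fun l => by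
    induction l with
    | zero => exact fun t => ⟨[], rfl, by simp [eWord]⟩
    | succ l ih =>
      intro t
      obtain ⟨u, hl, hu⟩ := ih (next t)
      refine ⟨lab t :: u, by simp [hl], ?_⟩
      rw [hnext t, hu, eWord_cons, mul_smul, Function.iterate_succ_apply]
  -- The steps backwards from `t₀` repeat, as `T` is finite; a repetition is a ring.
  let t₀ : T := (⟨v, rfl⟩, 0)
  obtain ⟨a, b, hne, hab⟩ := Finite.exists_ne_map_eq_of_infinite fun l : ℕ => next^[l] t₀
  wlog hlt : a < b generalizing a b
  · exact this b a hne.symm hab.symm (by omega)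
  obtain ⟨u, hl, hu⟩ := hiter (b - a) (next^[a] t₀)
  obtain ⟨u'', -, hu''⟩ := hiter a t₀
  rw [← Function.iterate_add_apply, Nat.sub_add_cancel hlt.le] at hu
  rw [← hab] at hu
  refine ⟨u, u', u'', _, _, ?_, hu.symm, ?_, hu''⟩
  · rintro rfl
    simp at hl
    omega
  · simp [q, t₀, mul_smul]

variable [DecidableEq G]
variable {H : Type*} [NormedAddCommGroup H] [InnerProductSpace ℂ H] [CompleteSpace H]
variable {π : FTheta θ →* (H →L[ℂ] H)} {V : EllTwo G →ₗᵢ[ℂ] H}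

theorem IsCarrier.isAtomic (h : IsCarrier 𝒢 π V) : IsAtomic π h.basis where
  partiallyIsometric w := by
    ext x
    rw [mul_apply_eq_comp, mul_apply_eq_comp]
    congr 1
    refine ext_inner_right ℂ fun z => ?_
    rw [ContinuousLinearMap.star_eq_adjoint, ContinuousLinearMap.adjoint_inner_left,
      h.starRep.inner_map]
  permutes w z := by
    obtain ⟨c, hc, hz⟩ := h.moves w z
    exact ⟨_, c, Or.inl hc, hz⟩

theorem IsCarrier.blueEdge_iff (h : IsCarrier 𝒢 π V) (z z' : 𝒢.Vertex) :
    BlueEdge π h.basis z z' ↔ ∃ i : Fin m, e θ i • z = z' :=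
  exists_congr fun _ => h.moves_iff _ _ _

theorem IsCarrier.redEdge_iff (h : IsCarrier 𝒢 π V) (z z' : 𝒢.Vertex) :
    RedEdge π h.basis z z' ↔ ∃ j : Fin n, f θ j • z = z' :=
  exists_congr fun _ => h.moves_iff _ _ _

theorem IsCarrier.isConnectedGraph (h : IsCarrier 𝒢 π V) : IsConnectedGraph π h.basis := by
  refine ⟨⟨𝒢.vertex 0⟩, ?_⟩
  set R := Relation.EqvGen fun x y => BlueEdge π h.basis x y ∨ RedEdge π h.basis x y
  have hR : Equivalence R := Relation.EqvGen.is_equivalence _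
  have hsmul : ∀ (w : FTheta θ) (z : 𝒢.Vertex), R z (w • z) := fun w z => by
    induction w using FTheta.induction with
    | one => rw [one_smul]; exact hR.refl z
    | e_mul i w ih =>
      rw [mul_smul]
      exact hR.trans ih (.rel _ _ (Or.inl ((h.blueEdge_iff _ _).2 ⟨i, rfl⟩)))
    | f_mul j w ih =>
      rw [mul_smul]
      exact hR.trans ih (.rel _ _ (Or.inr ((h.redEdge_iff _ _).2 ⟨j, rfl⟩)))
  have hadd : ∀ a g : G, R (𝒢.vertex g) (𝒢.vertex (g + a)) := fun a => by
    have ha : a ∈ AddSubgroup.closure {g₁, g₂} := by rw [𝒢.generate]; trivial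
    induction ha using AddSubgroup.closure_induction with
    | mem x hx =>
      intro g
      rcases hx with rfl | rfl
      · rw [← 𝒢.e_smul_vertex]; exact hsmul _ _
      · rw [← 𝒢.f_smul_vertex]; exact hsmul _ _
    | zero => intro g; rw [add_zero]; exact hR.refl _
    | add x y _ _ hx hy => intro g; rw [← add_assoc]; exact hR.trans (hx g) (hy _)
    | neg x _ hx => intro g; simpa using hR.symm (hx (g + -x))
  have h0 : ∀ z, R (𝒢.vertex 0) z := fun z => by
    obtain ⟨w, g, rfl⟩ := 𝒢.exists_eq_smul_vertex z
    have := hadd g 0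
    rw [zero_add] at this
    exact hR.trans this (hsmul w _)
  exact fun x y => hR.trans (hR.symm (h0 x)) (h0 y)

/-- Blue words act within a blue component. -/
theorem IsCarrier.eqvGen_blue (h : IsCarrier 𝒢 π V) (u : List (Fin m)) (z : 𝒢.Vertex) :
    Relation.EqvGen (BlueEdge π h.basis) (eWord θ u • z) z := by
  induction u with
  | nil => rw [eWord_nil, one_smul]; exact .refl _
  | cons i u ih =>
    rw [eWord_cons, mul_smul]
    exact .trans _ _ _ (.symm _ _ (.rel _ _ ((h.blueEdge_iff _ _).2 ⟨i, rfl⟩))) ih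

end Graph

section CyclicTimesIntegers

variable {m n : ℕ} {θ : Equiv.Perm (Fin m × Fin n)} {k : ℕ}
variable {𝒢 : GroupData θ (ZMod k × ℤ) (1, 0) (0, 1)}
variable {H : Type*} [NormedAddCommGroup H] [InnerProductSpace ℂ H] [CompleteSpace H]
variable {π : FTheta θ →* (H →L[ℂ] H)} {V : EllTwo (ZMod k × ℤ) →ₗᵢ[ℂ] H}

/-- A closed path in the graph of a dilation has no red edges, and its length is a multiple
of `k`. -/
theorem degrees_of_smul_eq_self {w : FTheta θ} {z : 𝒢.Vertex} (h : w • z = z) :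
    k ∣ blueDegree w ∧ redDegree w = 0 := by
  obtain ⟨a, b, h⟩ := 𝒢.smul_eq_self h
  rw [Prod.ext_iff] at h
  simp only [Prod.smul_mk, smul_zero, Prod.mk_add_mk, add_zero, zero_add, nsmul_eq_mul,
    mul_one] at h
  refine ⟨?_, by have := h.2; push_cast at this; omega⟩
  rw [← ZMod.natCast_eq_zero_iff]
  simpa using h.1

theorem IsCarrier.isLeast (h : IsCarrier 𝒢 π V) (hk : 0 < k) :
    IsLeast (blueReturnLengths π h.basis) k := by
  constructor
  · obtain ⟨u, hl, hu⟩ := 𝒢.exists_eWord_smul_vertex k 0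
    refine ⟨𝒢.vertex 0, u, ?_, hl, (h.moves_iff _ _ _).2 ?_⟩
    · rintro rfl
      exact hk.ne hl
    · rw [hu]
      congr 1
      simp
  · rintro _ ⟨z, u, hu, rfl, hz⟩
    have hdvd := (degrees_of_smul_eq_self ((h.moves_iff _ _ _).1 hz)).1
    rw [blueDegree_eWord] at hdvd
    exact Nat.le_of_dvd (List.length_pos_iff.2 hu) hdvd

theorem IsCarrier.isRingByTail (h : IsCarrier 𝒢 π V) (hk : 0 < k) :
    IsRingByTail π h.basis where
  starRep := h.starRep
  atomic := h.isAtomic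
  connected := h.isConnectedGraph
  blue_ring z := by
    obtain ⟨u, u', u'', y, z', hu, hy, rfl, rfl⟩ := exists_blue_ring hk (by simp) z
    refine ⟨y, u, ?_, hu, (h.moves_iff _ _ _).2 hy⟩
    rw [← mul_smul, ← eWord_append]
    exact h.eqvGen_blue _ _
  red_tail z := by
    choose lab pred hpred using 𝒢.exists_eq_f_smul
    have hedge : ∀ t, RedEdge π h.basis (pred^[t + 1] z) (pred^[t] z) := fun t => by
      rw [Function.iterate_succ_apply']
      exact (h.redEdge_iff _ _).2 ⟨_, (hpred _).symm⟩
    have hiter : ∀ (l : ℕ) (z : 𝒢.Vertex), ∃ v : List (Fin n), v.length = l ∧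
        z = fWord θ v • pred^[l] z := fun l => by
      induction l with
      | zero => exact fun z => ⟨[], rfl, by simp [fWord]⟩
      | succ l ih =>
        intro z
        obtain ⟨v, hl, hv⟩ := ih (pred z)
        refine ⟨lab z :: v, by simp [hl], ?_⟩
        rw [fWord_cons, mul_smul, Function.iterate_succ_apply, ← hv, ← hpred]
    -- A repetition in the sequence of red predecessors would be a closed red path.
    refine ⟨fun t => pred^[t] z, fun a b hab => ?_, fun t => ?_, hedge⟩
    · by_contra hne
      wlog hlt : a < b generalizing a b
      · exact this b a hab.symm (Ne.symm hne) (by omega)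
      obtain ⟨v, hl, hv⟩ := hiter (b - a) (pred^[a] z)
      rw [← Function.iterate_add_apply, Nat.sub_add_cancel hlt.le] at hv
      dsimp only at hab
      rw [← hab] at hv
      have := (degrees_of_smul_eq_self hv.symm).2
      rw [redDegree_fWord] at this
      omega
    · induction t with
      | zero => exact .refl _
      | succ t ih => exact .trans _ _ _ ih (.symm _ _ (.rel _ _ (hedge t)))

end CyclicTimesIntegers

end GroupData

/-! ### A model of the minimal dilation -/

section OfOrthonormal

variable {H : Type*} [NormedAddCommGroup H] [InnerProductSpace ℂ H] {κ : Type*}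

theorem ext_single [DecidableEq κ] {S T : EllTwo κ →L[ℂ] H}
    (h : ∀ x, S (lp.single 2 x 1) = T (lp.single 2 x 1)) : S = T := by
  refine ContinuousLinearMap.ext_on
    (s := Set.range fun x : κ => (lp.single 2 x (1 : ℂ) : EllTwo κ))
    (Submodule.dense_iff_topologicalClosure_eq_top.2 GroupData.dense_span_single) ?_
  rintro _ ⟨x, rfl⟩
  exact h x

variable [CompleteSpace H]

/-- The isometry of `ℓ²(κ)` which maps the standard basis to a given orthonormal family. -/
def ofOrthonormal {v : κ → H} (hv : Orthonormal ℂ v) : EllTwo κ →ₗᵢ[ℂ] H :=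
  hv.orthogonalFamily.linearIsometry

theorem ofOrthonormal_single [DecidableEq κ] {v : κ → H} (hv : Orthonormal ℂ v) (x : κ) :
    ofOrthonormal hv (lp.single 2 x 1) = v x := by
  rw [ofOrthonormal, OrthogonalFamily.linearIsometry_apply_single,
    LinearIsometry.toSpanSingleton_apply, one_smul]

theorem orthonormal_single_comp {ι : Type*} [DecidableEq ι] {φ : κ → ι}
    (hφ : Function.Injective φ) :
    Orthonormal ℂ fun x => (lp.single 2 (φ x) (1 : ℂ) : EllTwo ι) :=
  ⟨fun _ => GroupData.norm_single_one _, fun x y hxy => by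
    dsimp only
    rw [GroupData.inner_single_single, if_neg (hφ.ne hxy)]⟩

end OfOrthonormal

namespace GroupData

section Model

variable {m n : ℕ} {θ : Equiv.Perm (Fin m × Fin n)} {G : Type*} [AddCommGroup G] {g₁ g₂ : G}
variable (𝒢 : GroupData θ G g₁ g₂)

open Classical in
/-- The isometry of `ℓ²` of the set of vertices which maps the basis vector at `z` to the basis
vector at `w • z`. -/
def vertexShift (w : FTheta θ) : EllTwo 𝒢.Vertex →ₗᵢ[ℂ] EllTwo 𝒢.Vertex :=
  ofOrthonormal (orthonormal_single_comp (φ := fun z : 𝒢.Vertex => w • z)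
    fun _ _ => 𝒢.smul_left_injective_vertex w)

open Classical in
theorem vertexShift_single (w : FTheta θ) (z : 𝒢.Vertex) :
    𝒢.vertexShift w (lp.single 2 z 1) = lp.single 2 (w • z) 1 :=
  ofOrthonormal_single (orthonormal_single_comp (φ := fun z : 𝒢.Vertex => w • z)
    fun _ _ => 𝒢.smul_left_injective_vertex w) z

/-- The representation on `ℓ²` of the set of vertices for which each blue edge has the
scalar `α` and each red edge has the scalar `1`. -/
def model (α : Circle) : FTheta θ →* (EllTwo 𝒢.Vertex →L[ℂ] EllTwo 𝒢.Vertex) where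
  toFun w := (α : ℂ) ^ blueDegree w • (𝒢.vertexShift w).toContinuousLinearMap
  map_one' := by
    classical
    refine ext_single fun z => ?_
    simp [vertexShift_single]
  map_mul' w w' := by
    classical
    refine ext_single fun z => ?_
    change (α : ℂ) ^ blueDegree (w * w') • 𝒢.vertexShift (w * w') (lp.single 2 z 1) =
      (α : ℂ) ^ blueDegree w • 𝒢.vertexShift w
        ((α : ℂ) ^ blueDegree w' • 𝒢.vertexShift w' (lp.single 2 z 1))
    rw [(𝒢.vertexShift w).map_smul, vertexShift_single, vertexShift_single, vertexShift_single,
      smul_smul, blueDegree_mul, pow_add, mul_smul w w' z]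

open Classical in
theorem model_single (α : Circle) (w : FTheta θ) (z : 𝒢.Vertex) :
    𝒢.model α w (lp.single 2 z 1) = (α : ℂ) ^ blueDegree w • lp.single 2 (w • z) 1 := by
  rw [← vertexShift_single]
  rfl

theorem isometry_model (α : Circle) (w : FTheta θ) : Isometry (𝒢.model α w) := by
  refine AddMonoidHomClass.isometry_of_norm _ fun x => ?_
  change ‖(α : ℂ) ^ blueDegree w • 𝒢.vertexShift w x‖ = ‖x‖
  rw [norm_smul, norm_pow, Circle.norm_coe, one_pow, one_mul, LinearIsometry.norm_map]

theorem inner_model_eq_zero (α : Circle) {w w' : FTheta θ}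
    (h : ∀ z z' : 𝒢.Vertex, w • z ≠ w' • z') (x y : EllTwo 𝒢.Vertex) :
    ⟪𝒢.model α w x, 𝒢.model α w' y⟫_ℂ = 0 := by
  classical
  have h0 : star (𝒢.model α w') * 𝒢.model α w = 0 := by
    refine ext_single fun z => ?_
    have h1 : innerSL ℂ (𝒢.model α w (lp.single 2 z 1)) ∘L 𝒢.model α w' = 0 := by
      refine ext_single fun z' => ?_
      rw [ContinuousLinearMap.comp_apply, innerSL_apply_apply, model_single, model_single,
        inner_smul_left, inner_smul_right, inner_single_single, if_neg (h z z'), mul_zero,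
        mul_zero]
      rfl
    refine ext_inner_right ℂ fun y => ?_
    rw [mul_apply_eq_comp, ContinuousLinearMap.star_eq_adjoint,
      ContinuousLinearMap.adjoint_inner_left]
    simpa using DFunLike.congr_fun h1 y
  rw [← ContinuousLinearMap.adjoint_inner_left, ← ContinuousLinearMap.star_eq_adjoint,
    ← mul_apply_eq_comp, h0]
  simp

open Classical in
/-- The standard basis of `ℓ²` of the set of vertices. -/
def vertexBasis : HilbertBasis 𝒢.Vertex ℂ (EllTwo 𝒢.Vertex) :=
  HilbertBasis.ofRepr (LinearIsometryEquiv.refl ℂ _)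

open Classical in
theorem vertexBasis_apply (z : 𝒢.Vertex) : 𝒢.vertexBasis z = lp.single 2 z 1 := by
  rw [← HilbertBasis.repr_symm_single]
  rfl

theorem isStarRep_model (α : Circle) : IsStarRep (𝒢.model α) where
  isometric := 𝒢.isometry_model α
  defectFree := by
    classical
    have hb : ∀ (w : FTheta θ) (z : 𝒢.Vertex), 𝒢.vertexBasis (w • z : 𝒢.Vertex) =
        𝒢.model α w (((α : ℂ) ^ blueDegree w)⁻¹ • lp.single 2 z 1) := fun w z => by
      rw [(𝒢.model α w).map_smul, model_single, smul_smul,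
        inv_mul_cancel₀ (pow_ne_zero _ (Circle.coe_ne_zero α)), one_smul, vertexBasis_apply]
    constructor
    · refine sum_eq_one_of_basis (S := fun i => 𝒢.model α (e θ i)) 𝒢.vertexBasis
        (fun i => 𝒢.isometry_model α _) (fun i j hij => 𝒢.inner_model_eq_zero α
          fun z z' h => hij (𝒢.e_smul_inj h)) fun z => ?_
      obtain ⟨i, z', rfl⟩ := 𝒢.exists_eq_e_smul z
      exact ⟨i, _, hb _ _⟩
    · refine sum_eq_one_of_basis (S := fun j => 𝒢.model α (f θ j)) 𝒢.vertexBasis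
        (fun j => 𝒢.isometry_model α _) (fun i j hij => 𝒢.inner_model_eq_zero α
          fun z z' h => hij (𝒢.f_smul_inj h)) fun z => ?_
      obtain ⟨j, z', rfl⟩ := 𝒢.exists_eq_f_smul z
      exact ⟨j, _, hb _ _⟩

open Classical in
/-- The inclusion of `ℓ²(G)` in the space of the model. -/
def modelEmbedding : EllTwo G →ₗᵢ[ℂ] EllTwo 𝒢.Vertex :=
  ofOrthonormal (orthonormal_single_comp 𝒢.vertex_injective)

/-- The model is a minimal `*`-dilation of the group construction if the scalars of the latter are
constant. -/
theorem isCarrier_model [DecidableEq G] {α : Circle} (hα : ∀ g, 𝒢.α g = α) (hβ : ∀ g, 𝒢.β g = 1) :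
    IsCarrier 𝒢 (𝒢.model α) 𝒢.modelEmbedding where
  starRep := 𝒢.isStarRep_model α
  map_e g := by
    classical
    simp [modelEmbedding, ofOrthonormal_single, model_single, e_smul_vertex, hα]
  map_f g := by
    classical
    simp [modelEmbedding, ofOrthonormal_single, model_single, f_smul_vertex, hβ]
  dense := by
    classical
    rw [eq_top_iff, ← dense_span_single]
    refine Submodule.topologicalClosure_mono (Submodule.span_le.2 ?_)
    rintro _ ⟨z, rfl⟩
    obtain ⟨w, g, rfl⟩ := 𝒢.exists_eq_smul_vertex z
    have h : (lp.single 2 (w • 𝒢.vertex g) 1 : EllTwo 𝒢.Vertex) =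
        ((α : ℂ) ^ blueDegree w)⁻¹ • atom (𝒢.model α) 𝒢.modelEmbedding (g, w) := by
      rw [atom, modelEmbedding, ofOrthonormal_single, model_single, smul_smul,
        inv_mul_cancel₀ (pow_ne_zero _ (Circle.coe_ne_zero α)), one_smul]
    change lp.single 2 (w • 𝒢.vertex g) 1 ∈ _
    rw [h]
    exact Submodule.smul_mem _ _ (Submodule.subset_span ⟨_, rfl⟩)

end Model

end GroupData

/-! ### The group construction given by ring by tail data -/

namespace RingTailData

variable {m n : ℕ} {θ : Equiv.Perm (Fin m × Fin n)} {k : ℕ} (D : RingTailData θ k)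

/-- The red labels of a strip of squares, given the labels `I` of the upper blue edges and the label
`j` of the leftmost red edge. -/
def stripLabel (θ : Equiv.Perm (Fin m × Fin n)) (I : ℕ → Fin m) (j : Fin n) : ℕ → Fin n
  | 0 => j
  | s + 1 => (θ (I s, stripLabel θ I j s)).2

/-- The labels `i_{s,-t}` of the blue edges, for `s, t ≥ 0`. -/
def blueRow : ℕ → ℕ → Fin m
  | 0, s => D.u.reverse[s % k]'(by
      rw [List.length_reverse, D.length_u]
      exact Nat.mod_lt _ D.k_pos)
  | t + 1, s => (θ (blueRow t s, stripLabel θ (blueRow t) (D.v t) s)).1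

/-- The labels `j_{s,-t-1}` of the red edges, for `s, t ≥ 0`. -/
def redRow (t s : ℕ) : Fin n := stripLabel θ (D.blueRow t) (D.v t) s

theorem redRow_zero (t : ℕ) : D.redRow t 0 = D.v t := rfl

/-- The commutation relation of the square with upper right corner `(s + 1, -t)`. -/
theorem square (t s : ℕ) :
    θ (D.blueRow t s, D.redRow t s) = (D.blueRow (t + 1) s, D.redRow t (s + 1)) := rfl

/-- The word `I_{s-1} ⋯ I_0`. -/
def rowWord (I : ℕ → Fin m) (s : ℕ) : List (Fin m) := ((List.range s).map I).reverse

theorem rowWord_succ (I : ℕ → Fin m) (s : ℕ) : rowWord I (s + 1) = I s :: rowWord I s := by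
  simp [rowWord, List.range_succ]

theorem length_rowWord (I : ℕ → Fin m) (s : ℕ) : (rowWord I s).length = s := by simp [rowWord]

theorem rowWord_blueRow_zero : rowWord (D.blueRow 0) k = D.u := by
  rw [rowWord, ← List.reverse_inj, List.reverse_reverse]
  refine List.ext_getElem (by simp [D.length_u]) fun s h1 h2 => ?_
  have hs : s < k := by simpa using h1
  simp [blueRow, Nat.mod_eq_of_lt hs]

theorem eWord_rowWord_mul_f (t s : ℕ) :
    eWord θ (rowWord (D.blueRow t) s) * f θ (D.v t) =
      f θ (D.redRow t s) * eWord θ (rowWord (D.blueRow (t + 1)) s) := by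
  induction s with
  | zero => simp [rowWord, eWord, redRow_zero]
  | succ s ih =>
    rw [rowWord_succ, rowWord_succ, eWord_cons, eWord_cons, mul_assoc, ih, ← mul_assoc, e_mul_f,
      D.square, mul_assoc]

theorem eWord_mul_fWord (T : ℕ) :
    eWord θ D.u * fWord θ ((List.range T).map D.v) =
      fWord θ ((List.range T).map fun t => D.redRow t k) *
        eWord θ (rowWord (D.blueRow T) k) := by
  induction T with
  | zero => simp [fWord, D.rowWord_blueRow_zero]
  | succ T ih =>
    rw [List.range_succ, List.map_append, List.map_append, fWord_append, fWord_append,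
      ← mul_assoc, ih, List.map_singleton, List.map_singleton, fWord_singleton, fWord_singleton,
      mul_assoc, eWord_rowWord_mul_f, mul_assoc]

/-- The commutation relation at `t_r` forces the right boundary of the strip of width `k` to agree
with the left one down to the height `t_r`, and the row at that height to be `u₀`. -/
theorem strip_repeats (r : ℕ) :
    (∀ t < D.t r, D.redRow t k = D.v t) ∧ rowWord (D.blueRow (D.t r)) k = D.u := by
  have h := (D.eWord_mul_fWord (D.t r)).symm.trans (D.commute r)
  obtain ⟨h1, h2⟩ := fWord_mul_eWord_inj h (by simp) (by rw [length_rowWord, D.length_u])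
  refine ⟨fun t ht => ?_, h2⟩
  rw [List.map_inj_left] at h1
  exact h1 t (List.mem_range.2 ht)

/-- The commutation relations of the data make the grid of labels `k`-periodic. -/
theorem redRow_length (t : ℕ) : D.redRow t k = D.v t :=
  (D.strip_repeats (t + 1)).1 t (D.t_strictMono.id_le (t + 1))

theorem stripLabel_periodic {I : ℕ → Fin m} {j : Fin n} (hI : Function.Periodic I k)
    (hj : stripLabel θ I j k = j) : Function.Periodic (stripLabel θ I j) k := fun s => by
  induction s with
  | zero => rw [zero_add, hj, stripLabel]
  | succ s ih => rw [Nat.add_right_comm, stripLabel, stripLabel, ih, hI]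

theorem blueRow_periodic (t : ℕ) : Function.Periodic (D.blueRow t) k := by
  induction t with
  | zero => intro s; simp [blueRow]
  | succ t ih =>
    intro s
    rw [blueRow, blueRow, ih, stripLabel_periodic ih (D.redRow_length t)]

theorem redRow_periodic (t : ℕ) : Function.Periodic (D.redRow t) k :=
  stripLabel_periodic (D.blueRow_periodic t) (D.redRow_length t)

theorem blueRow_t (r : ℕ) : D.blueRow (D.t r) = D.blueRow 0 := by
  have h := (D.strip_repeats r).2.trans D.rowWord_blueRow_zero.symm
  rw [rowWord, rowWord, List.reverse_inj, List.map_inj_left] at h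
  funext s
  rw [← (D.blueRow_periodic _).map_mod_nat, ← (D.blueRow_periodic 0).map_mod_nat]
  exact h _ (List.mem_range.2 (Nat.mod_lt _ D.k_pos))

/-- The level of the grid which is used at height `t`.  Above height `0` the strip between the
heights `t₁` and `0`, whose length `-t₁` is `D.t 0`, is repeated periodically. -/
def depth (t : ℤ) : ℕ := if t ≤ 0 then (-t).toNat else ((-t) % (D.t 0 : ℤ)).toNat

/-- The row used at height `t` is the one below the row used at height `t + 1`;
at the joints of the repeated strip this holds because its first and last rows agree. -/
theorem blueRow_depth (t : ℤ) : D.blueRow (D.depth t) = D.blueRow (D.depth (t + 1) + 1) := by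
  have hT := D.t_pos 0
  by_cases ht : t < 0
  · rw [depth, depth, if_pos (by omega), if_pos (by omega)]
    congr 1
    omega
  · have h0 : D.depth t = ((-t) % (D.t 0 : ℤ)).toNat := by
      rw [depth]
      split_ifs with h
      · obtain rfl : t = 0 := by omega
        simp
      · rfl
    rw [h0, depth, if_neg (by omega)]
    have hT' : (0 : ℤ) < D.t 0 := by exact_mod_cast hT
    set r := (-(t + 1)) % (D.t 0 : ℤ) with hr
    have hr0 : 0 ≤ r := Int.emod_nonneg _ hT'.ne'
    have hr1 : r < D.t 0 := Int.emod_lt_of_pos _ hT'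
    have hmod : (-t) % (D.t 0 : ℤ) = (r + 1) % (D.t 0 : ℤ) := by
      rw [hr, Int.emod_add_emod]
      congr 1
      ring
    rw [hmod]
    by_cases h1 : r + 1 < D.t 0
    · rw [Int.emod_eq_of_lt (by omega) h1]
      congr 1
      omega
    · have h2 : r + 1 = D.t 0 := by omega
      have h3 : r.toNat + 1 = D.t 0 := by omega
      rw [h2, h3, Int.emod_self, Int.toNat_zero, D.blueRow_t]

/-- A `k`-periodic function does not see that the value of `s + 1` is reduced modulo `k`. -/
theorem val_add_one [NeZero k] {X : Type*} {φ : ℕ → X} (hφ : Function.Periodic φ k) (s : ZMod k) :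
    φ (s + 1).val = φ (s.val + 1) := by
  rw [ZMod.val_add, ZMod.val_one_eq_one_mod, Nat.add_mod_mod, hφ.map_mod_nat]

theorem closure_generators (k : ℕ) :
    AddSubgroup.closure {((1 : ZMod k), (0 : ℤ)), ((0 : ZMod k), (1 : ℤ))} = ⊤ := by
  rw [eq_top_iff]
  rintro ⟨s, t⟩ -
  obtain ⟨a, rfl⟩ := ZMod.intCast_surjective s
  have h : ((a : ZMod k), t) = a • ((1 : ZMod k), (0 : ℤ)) + t • ((0 : ZMod k), (1 : ℤ)) := by
    simp
  rw [h]
  exact add_mem (zsmul_mem (AddSubgroup.subset_closure (by simp)) _)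
    (zsmul_mem (AddSubgroup.subset_closure (by simp)) _)

/-- The group construction with the labels of the periodic grid, the blue scalar `α` and the red
scalar `1`. -/
def groupData : GroupData θ (ZMod k × ℤ) (1, 0) (0, 1) where
  generate := closure_generators k
  i g := D.blueRow (D.depth g.2) g.1.val
  j g := D.redRow (D.depth (g.2 + 1)) g.1.val
  α _ := D.α
  β _ := 1
  comm g := by
    have : NeZero k := ⟨D.k_pos.ne'⟩
    obtain ⟨s, t⟩ := g
    simp only [Prod.mk_add_mk, add_zero]
    rw [D.square, val_add_one (D.redRow_periodic _), D.blueRow_depth t]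
  comm_scalar _ := by rw [one_mul, mul_one]

theorem realizes_groupData : Realizes D.groupData D where
  ring := by
    rw [← D.rowWord_blueRow_zero, rowWord, List.reverse_inj]
    refine List.ext_getElem (by simp) fun s h1 h2 => ?_
    have hs : s < k := by simpa using h1
    simp [groupData, depth, ZMod.val_natCast, Nat.mod_eq_of_lt hs]
  tail t := by
    have : D.depth (-((t : ℤ) + 1) + 1) = t := by
      rw [depth, if_pos (by omega)]
      omega
    change D.v t = D.redRow (D.depth (-((t : ℤ) + 1) + 1)) (0 : ZMod k).val
    rw [this, ZMod.val_zero, redRow_zero]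
  scalar_blue _ := rfl
  scalar_red _ := rfl

end RingTailData

/-! ### Ring by tail data and group constructions -/

section Correspondence

variable {m n : ℕ} {θ : Equiv.Perm (Fin m × Fin n)} {k : ℕ}
variable {𝒢 : GroupData θ (ZMod k × ℤ) (1, 0) (0, 1)} {D : RingTailData θ k}

theorem Realizes.u_eq (h : Realizes 𝒢 D) :
    D.u = RingTailData.rowWord (fun s => 𝒢.i ((s : ZMod k), 0)) k := by
  rw [h.ring, RingTailData.rowWord, List.reverse_inj]
  exact List.ext_getElem (by simp) fun s h1 h2 => by simp

variable {H : Type*} [NormedAddCommGroup H] [InnerProductSpace ℂ H]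
variable {π : FTheta θ →* (H →L[ℂ] H)}

/-- The effect of walking `s` steps along the row of height `t`. -/
theorem map_rowWord {A : ZMod k × ℤ → H} {α : ℂ}
    (hA : ∀ g, π (e θ (𝒢.i g)) (A g) = α • A (g + (1, 0))) (t : ℤ) (s : ℕ) :
    π (eWord θ (RingTailData.rowWord (fun s => 𝒢.i ((s : ZMod k), t)) s)) (A (0, t)) =
      α ^ s • A (s, t) := by
  induction s with
  | zero => simp [RingTailData.rowWord, eWord]
  | succ s ih =>
    rw [RingTailData.rowWord_succ, eWord_cons, map_mul, mul_apply_eq_comp, ih, map_smul, hA,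
      smul_smul, pow_succ]
    simp

variable [CompleteSpace H]

theorem GroupData.IsCarrier.hasData {V : EllTwo (ZMod k × ℤ) →ₗᵢ[ℂ] H}
    (h : GroupData.IsCarrier 𝒢 π V) (hD : Realizes 𝒢 D) :
    HasData π h.basis (𝒢.vertex 0) D where
  minimal := h.isLeast D.k_pos
  ring := by
    have hV : ∀ g, π (e θ (𝒢.i g)) (V (lp.single 2 g 1)) =
        (D.α : ℂ) • V (lp.single 2 (g + (1, 0)) 1) := fun g => by
      rw [h.map_e, hD.scalar_blue]
    have := map_rowWord (A := fun g => V (lp.single 2 g 1)) hV 0 k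
    rw [← hD.u_eq, ZMod.natCast_self] at this
    rw [h.basis_vertex]
    exact this
  tail t := by
    refine ⟨𝒢.vertex (0, -(t : ℤ)), (h.moves_iff _ _ _).2 ?_⟩
    induction t with
    | zero => simp [fWord, Prod.mk_zero_zero]
    | succ t ih =>
      rw [List.range_succ, List.map_append, fWord_append, List.map_singleton, fWord_singleton,
        mul_smul, hD.tail, Nat.cast_succ, GroupData.f_smul_vertex]
      rw [← ih]
      congr 2
      simp

variable {ι : Type*} {b : HilbertBasis ι ℂ H}

/-- A family of vertices of a ring by tail representation which is labelled like a group
construction on `𝒞_k × ℤ` has distinct vertices if `k` is the minimal size of a ring. If two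
vertices coincide, then so do those obtained by a translation downwards or along a ring; a
coincidence on the same level thus gives a shorter blue ring, and a coincidence between different
levels gives a red ring. -/
theorem injective_of_moves (hR : IsRingByTail π b) (hk : IsLeast (blueReturnLengths π b) k)
    {y : ZMod k × ℤ → ι} (hE : ∀ g, Moves π b (e θ (𝒢.i g)) (y g) (y (g + (1, 0))))
    (hF : ∀ g, Moves π b (f θ (𝒢.j g)) (y g) (y (g + (0, 1)))) : Function.Injective y := by
  have hk0 : 0 < k := by
    obtain ⟨_, u, hu, rfl, _⟩ := hk.1
    exact List.length_pos_iff.2 hu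
  have : NeZero k := ⟨hk0.ne'⟩
  have hblue : ∀ {g h}, y g = y h → ∀ s : ZMod k, y (g + (s, 0)) = y (h + (s, 0)) := by
    have h1 : ∀ {g h}, y g = y h → y (g - (1, 0)) = y (h - (1, 0)) := fun {g h} hgh => by
      have hg := hE (g - (1, 0))
      have hh := hE (h - (1, 0))
      rw [sub_add_cancel] at hg hh
      rw [← hgh] at hh
      exact (hg.unique hR.starRep hh (by simp) (by simp)).2
    have h2 : ∀ {g h}, y g = y h → ∀ l : ℕ, y (g - ((l : ZMod k), 0)) = y (h - ((l : ZMod k), 0)) :=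
      fun {g h} hgh l => by
        induction l with
        | zero => simpa [Prod.mk_zero_zero] using hgh
        | succ l ih =>
          have := h1 ih
          rw [sub_sub, sub_sub] at this
          simpa using this
    intro g h hgh s
    -- In `ZMod k` a translation by `s` is `(-s).val` steps backwards.
    have := h2 hgh (-s).val
    rw [ZMod.natCast_val, ZMod.cast_id] at this
    convert this using 2 <;> rw [sub_eq_add_neg] <;> simp
  have hred : ∀ {g h}, y g = y h → ∀ l : ℕ, y (g + (0, -(l : ℤ))) = y (h + (0, -(l : ℤ))) := by
    have h1 : ∀ {g h}, y g = y h → y (g - (0, 1)) = y (h - (0, 1)) := fun {g h} hgh => by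
      have hg := hF (g - (0, 1))
      have hh := hF (h - (0, 1))
      rw [sub_add_cancel] at hg hh
      rw [← hgh] at hh
      exact (hg.unique hR.starRep hh (by simp) (by simp)).2
    intro g h hgh l
    induction l with
    | zero => simpa [Prod.mk_zero_zero] using hgh
    | succ l ih =>
      have := h1 ih
      rw [add_sub_assoc, add_sub_assoc] at this
      convert this using 3 <;> simp <;> ring
  have hpathE : ∀ (l : ℕ) (g : ZMod k × ℤ), ∃ u : List (Fin m), u.length = l ∧
      Moves π b (eWord θ u) (y g) (y (g + ((l : ZMod k), 0))) := fun l g => by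
    induction l with
    | zero =>
      refine ⟨[], rfl, ?_⟩
      simpa [eWord, Prod.mk_zero_zero] using Moves.one (π := π) (b := b) (y g)
    | succ l ih =>
      obtain ⟨u, hl, hu⟩ := ih
      refine ⟨𝒢.i (g + ((l : ZMod k), 0)) :: u, by simp [hl], ?_⟩
      rw [eWord_cons]
      have := (hE _).mul hu
      rw [add_assoc] at this
      simpa using this
  have hpathF : ∀ (l : ℕ) (g : ZMod k × ℤ), ∃ v : List (Fin n), v.length = l ∧
      Moves π b (fWord θ v) (y g) (y (g + (0, (l : ℤ)))) := fun l g => by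
    induction l with
    | zero =>
      refine ⟨[], rfl, ?_⟩
      simpa [fWord, Prod.mk_zero_zero] using Moves.one (π := π) (b := b) (y g)
    | succ l ih =>
      obtain ⟨v, hl, hv⟩ := ih
      refine ⟨𝒢.j (g + (0, (l : ℤ))) :: v, by simp [hl], ?_⟩
      rw [fWord_cons]
      have := (hF _).mul hv
      rw [add_assoc] at this
      simpa using this
  have hlevel : ∀ (g : ZMod k × ℤ) (δ : ZMod k) (d : ℕ), y g = y (g + (δ, -(d : ℤ))) → d = 0 := by
    intro g δ d hgd
    have hiter : ∀ l : ℕ, y g = y (g + ((l : ZMod k) * δ, -((l * d : ℕ) : ℤ))) := fun l => by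
      induction l with
      | zero => simp [Prod.mk_zero_zero]
      | succ l ih =>
        have h1 := hred (hblue hgd ((l : ZMod k) * δ)) (l * d)
        rw [add_assoc, add_assoc, add_assoc] at h1
        simp only [Prod.mk_add_mk, add_zero, zero_add] at h1
        rw [ih, h1]
        congr 2
        ext
        · push_cast; ring
        · push_cast; ring
    -- After `k` translations the first coordinate returns, and a closed red path remains.
    have h1 := hiter k
    rw [ZMod.natCast_self, zero_mul] at h1
    obtain ⟨v, hl, hv⟩ := hpathF (k * d) (g + (0, -((k * d : ℕ) : ℤ)))
    rw [← h1, add_assoc] at hv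
    simp only [Prod.mk_add_mk, neg_add_cancel, add_zero] at hv
    rw [Prod.mk_zero_zero, add_zero] at hv
    by_contra hd
    refine hR.not_moves_fWord (v := v) ?_ _ hv
    rintro rfl
    have : k * d ≠ 0 := mul_ne_zero hk0.ne' hd
    exact this hl.symm
  intro g h hgh
  have h2 : g.2 = h.2 := by
    by_contra hne
    wlog hlt : h.2 < g.2 generalizing g h
    · exact this hgh.symm (Ne.symm hne) (by omega)
    have h0 := hlevel g (h.1 - g.1) (g.2 - h.2).toNat (by
      rw [hgh]
      congr 1
      ext
      · simp
      · simp; omega)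
    omega
  by_contra hne
  obtain ⟨u, hl, hu⟩ := hpathE (h.1 - g.1).val g
  have hgh' : g + (((h.1 - g.1).val : ZMod k), 0) = h := by
    ext
    · simp
    · simpa using h2
  rw [hgh', ← hgh] at hu
  have hu0 : u ≠ [] := by
    rintro rfl
    have h0 : h.1 - g.1 = 0 := (ZMod.val_eq_zero _).1 hl.symm
    exact hne (Prod.ext (sub_eq_zero.1 h0).symm h2)
  have := hk.2 ⟨_, u, hu0, rfl, hu⟩
  have hlt := ZMod.val_lt (h.1 - g.1)
  omega

/-- By connectedness, every vertex is reached from a family of vertices which is labelled like a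
group construction: with a vertex, its predecessors are reached too, since the word of a path from
the family, extended backwards by an edge of the family, can be rewritten to begin with a letter of
the colour of that edge. -/
theorem exists_moves_of_connected (hR : IsRingByTail π b) {G : Type*} [AddCommGroup G] [Nonempty G]
    {g₁ g₂ : G} {𝒢 : GroupData θ G g₁ g₂} {y : G → ι}
    (hE : ∀ g, Moves π b (e θ (𝒢.i g)) (y g) (y (g + g₁)))
    (hF : ∀ g, Moves π b (f θ (𝒢.j g)) (y g) (y (g + g₂))) (z : ι) :
    ∃ w g, Moves π b w (y g) z := by
  have hfwd : ∀ {w' x x'}, Moves π b w' x x' → (∃ w g, Moves π b w (y g) x) →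
      ∃ w g, Moves π b w (y g) x' := fun {w' x x'} h ⟨w, g, hw⟩ => ⟨_, g, h.mul hw⟩
  have hbwd : ∀ {x x'}, BlueEdge π b x x' ∨ RedEdge π b x x' → (∃ w g, Moves π b w (y g) x') →
      ∃ w g, Moves π b w (y g) x := by
    rintro x x' (⟨i, h⟩ | ⟨j, h⟩) ⟨w, g, hw⟩
    · obtain ⟨i', w', hww⟩ := exists_mul_e_eq w (𝒢.i (g - g₁))
      have h1 := hE (g - g₁)
      rw [sub_add_cancel] at h1
      have h2 := hw.mul h1
      rw [hww] at h2
      obtain ⟨x'', h3, h4⟩ := h2.of_mul hR.atomic hR.starRep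
      obtain ⟨-, rfl⟩ := h.unique hR.starRep h4 (by simp) (by simp)
      exact ⟨w', _, h3⟩
    · obtain ⟨j', w', hww⟩ := exists_mul_f_eq w (𝒢.j (g - g₂))
      have h1 := hF (g - g₂)
      rw [sub_add_cancel] at h1
      have h2 := hw.mul h1
      rw [hww] at h2
      obtain ⟨x'', h3, h4⟩ := h2.of_mul hR.atomic hR.starRep
      obtain ⟨-, rfl⟩ := h.unique hR.starRep h4 (by simp) (by simp)
      exact ⟨w', _, h3⟩
  have hiff : ∀ {x x'}, Relation.EqvGen (fun x y => BlueEdge π b x y ∨ RedEdge π b x y) x x' →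
      ((∃ w g, Moves π b w (y g) x) ↔ ∃ w g, Moves π b w (y g) x') := by
    intro x x' h
    induction h with
    | rel x x' h =>
      exact ⟨fun hx => h.elim (fun ⟨_, h⟩ => hfwd h hx) fun ⟨_, h⟩ => hfwd h hx, hbwd h⟩
    | refl x => exact Iff.rfl
    | symm x x' _ ih => exact ih.symm
    | trans x x' x'' _ _ ih ih' => exact ih.trans ih'
  obtain ⟨g⟩ := ‹Nonempty G›
  exact (hiff (hR.connected.2 (y g) z)).1 ⟨1, g, Moves.one _⟩

/-- The vectors of the leftmost column: below `(0, 0)` they are found by the tail of the data, and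
above it the labels of the group construction are followed. -/
theorem HasData.exists_column {x : ι} (h : HasData π b x D) (hπ : IsStarRep π) (ha : IsAtomic π b)
    (hD : Realizes 𝒢 D) :
    ∃ A : ℤ → H, A 0 = b x ∧ (∀ t, π (f θ (𝒢.j (0, t))) (A t) = A (t + 1)) ∧
      ∀ t, ∃ (y : ι) (c : ℂ), ‖c‖ = 1 ∧ A t = c • b y := by
  choose y c hc hy using h.tail
  let bwd : ℕ → H := fun t => (c t)⁻¹ • b (y t)
  have hbwd : ∀ t, π (fWord θ ((List.range t).map D.v)) (bwd t) = b x := fun t => by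
    have hc0 : c t ≠ 0 := norm_ne_zero_iff.1 (by simp [hc])
    rw [map_smul, hy, smul_smul, inv_mul_cancel₀ hc0, one_smul]
  have hbwd0 : bwd 0 = b x := by simpa [fWord] using hbwd 0
  have hstep : ∀ t, π (f θ (D.v t)) (bwd (t + 1)) = bwd t := fun t => by
    refine (hπ.isometric (fWord θ ((List.range t).map D.v))).injective ?_
    rw [hbwd, ← hbwd (t + 1), List.range_succ, List.map_append, fWord_append, map_mul,
      List.map_singleton, fWord_singleton, mul_apply_eq_comp]
  let fwd : ℕ → H := fun t => Nat.rec (b x) (fun t z => π (f θ (𝒢.j (0, (t : ℤ)))) z) t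
  let A : ℤ → H := fun t => Int.casesOn t fwd fun t => bwd (t + 1)
  have hneg : ∀ t : ℕ, A (-(t : ℤ)) = bwd t := fun t => by
    cases t with
    | zero => exact hbwd0.symm
    | succ t => rfl
  refine ⟨A, rfl, fun t => ?_, fun t => ?_⟩
  · rcases t with t | t
    · rfl
    · have h1 : Int.negSucc t + 1 = -(t : ℤ) := by omega
      rw [h1, hneg, ← hstep, hD.tail, ← Int.negSucc_eq]
  · rcases t with t | t
    · induction t with
      | zero => exact ⟨x, 1, by simp, (one_smul ℂ (b x)).symm⟩
      | succ t ih =>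
        obtain ⟨z, d, hd, hz⟩ := ih
        obtain ⟨z', d', hd', hz'⟩ := ha.exists_moves hπ (f θ (𝒢.j (0, (t : ℤ)))) z
        refine ⟨z', d * d', by simp [hd, hd'], ?_⟩
        change π (f θ (𝒢.j (0, (t : ℤ)))) (A (Int.ofNat t)) = _
        rw [hz, map_smul, hz', smul_smul]
    · exact ⟨y (t + 1), (c (t + 1))⁻¹, by simp [hc], rfl⟩

/-- Multiples of basis vectors on which the representation acts like the group construction. -/
theorem HasData.exists_vectors {x : ι} (h : HasData π b x D) (hπ : IsStarRep π)
    (ha : IsAtomic π b) (hD : Realizes 𝒢 D) :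
    ∃ A : ZMod k × ℤ → H, A (0, 0) = b x ∧
      (∀ g, π (e θ (𝒢.i g)) (A g) = (D.α : ℂ) • A (g + (1, 0))) ∧
      (∀ g, π (f θ (𝒢.j g)) (A g) = A (g + (0, 1))) ∧
      ∀ g, ∃ (y : ι) (c : ℂ), ‖c‖ = 1 ∧ A g = c • b y := by
  have : NeZero k := ⟨D.k_pos.ne'⟩
  obtain ⟨A₀, hA0, hcol, hline⟩ := h.exists_column hπ ha hD
  have hα : (D.α : ℂ) ≠ 0 := Circle.coe_ne_zero _
  -- The row at height `t` starts in the column `A₀` and follows blue edges.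
  let A : ℕ → ℤ → H := fun s t => ((D.α : ℂ) ^ s)⁻¹ •
    π (eWord θ (RingTailData.rowWord (fun s => 𝒢.i ((s : ZMod k), t)) s)) (A₀ t)
  have hA00 : ∀ t, A 0 t = A₀ t := fun t => by simp [A, RingTailData.rowWord, eWord]
  have hE : ∀ (s : ℕ) t, π (e θ (𝒢.i ((s : ZMod k), t))) (A s t) = (D.α : ℂ) • A (s + 1) t :=
    fun s t => by
      simp only [A]
      rw [map_smul, RingTailData.rowWord_succ, eWord_cons, map_mul, mul_apply_eq_comp, smul_smul,
        pow_succ, mul_inv, mul_comm _ (D.α : ℂ)⁻¹, ← mul_assoc, mul_inv_cancel₀ hα, one_mul]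
  have hF : ∀ (s : ℕ) t, π (f θ (𝒢.j ((s : ZMod k), t))) (A s t) = A s (t + 1) := fun s t => by
    induction s with
    | zero => simpa [hA00] using hcol t
    | succ s ih =>
      have h1 := congrArg (fun w => π w (A s t)) (𝒢.e_mul_f_label ((s : ZMod k), t))
      simp only [map_mul, mul_apply_eq_comp, Prod.mk_add_mk, add_zero, hE] at h1
      rw [ih, hE, map_smul] at h1
      rw [Nat.cast_succ]
      exact (smul_right_injective H hα h1).symm
  -- Periodicity spreads upwards along red edges, and downwards by injectivity.
  have hper0 : ∀ t, A k t = A 0 t := by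
    have h0 : A k 0 = A 0 0 := by
      rw [hA00, hA0]
      simp only [A]
      rw [← hD.u_eq, hA0, h.ring, smul_smul, inv_mul_cancel₀ (pow_ne_zero _ hα), one_smul]
    intro t
    induction t using Int.induction_on with
    | zero => exact h0
    | succ t ih =>
      rw [← hF, ← hF, ih]
      simp
    | pred t ih =>
      refine (hπ.isometric (f θ (𝒢.j ((k : ZMod k), -(t : ℤ) - 1)))).injective ?_
      rw [hF k]
      have := hF 0 (-(t : ℤ) - 1)
      rw [Nat.cast_zero] at this
      rw [ZMod.natCast_self, this, sub_add_cancel, ih]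
  have hper : ∀ t, Function.Periodic (fun s => A s t) k := fun t s => by
    induction s with
    | zero => simpa using hper0 t
    | succ s ih =>
      refine smul_right_injective H hα ?_
      dsimp only at ih ⊢
      rw [Nat.add_right_comm, ← hE, ← hE, ih]
      simp
  refine ⟨fun g => A g.1.val g.2, ?_, fun g => ?_, fun g => ?_, fun g => ?_⟩
  · simp [hA00, hA0]
  · have h1 := RingTailData.val_add_one (hper g.2) g.1
    have h2 := hE g.1.val g.2
    rw [ZMod.natCast_val, ZMod.cast_id] at h2
    rw [h2, ← h1]
    simp
  · have h2 := hF g.1.val g.2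
    rw [ZMod.natCast_val, ZMod.cast_id] at h2
    rw [h2]
    simp
  · obtain ⟨y, c, hc, hy⟩ := hline g.2
    obtain ⟨y', c', hc', hy'⟩ := ha.exists_moves hπ
      (eWord θ (RingTailData.rowWord (fun s => 𝒢.i ((s : ZMod k), g.2)) g.1.val)) y
    refine ⟨y', ((D.α : ℂ) ^ g.1.val)⁻¹ * (c * c'), by simp [hc, hc', Circle.norm_coe], ?_⟩
    simp only [A]
    rw [hy, map_smul, hy', smul_smul, smul_smul, mul_assoc]

/-- A representation with data `D` is a minimal `*`-dilation of each group construction built from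
`D`. -/
theorem HasData.exists_isCarrier {x : ι} (h : HasData π b x D) (hR : IsRingByTail π b)
    (hD : Realizes 𝒢 D) :
    ∃ V : EllTwo (ZMod k × ℤ) →ₗᵢ[ℂ] H, GroupData.IsCarrier 𝒢 π V ∧
      V (lp.single 2 (0, 0) 1) = b x := by
  obtain ⟨A, hA0, hE, hF, hline⟩ := h.exists_vectors hR.starRep hR.atomic hD
  choose y c hc hy using hline
  have hc0 : ∀ g, c g ≠ 0 := fun g => norm_ne_zero_iff.1 (by simp [hc])
  have hby : ∀ g, b (y g) = (c g)⁻¹ • A g := fun g => by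
    rw [hy, smul_smul, inv_mul_cancel₀ (hc0 g), one_smul]
  have hmE : ∀ g, Moves π b (e θ (𝒢.i g)) (y g) (y (g + (1, 0))) := fun g =>
    ⟨(c g)⁻¹ * (D.α * c (g + (1, 0))), by simp [hc, Circle.norm_coe], by
      rw [hby, map_smul, hE, hy (g + _), smul_smul, smul_smul, mul_assoc]⟩
  have hmF : ∀ g, Moves π b (f θ (𝒢.j g)) (y g) (y (g + (0, 1))) := fun g =>
    ⟨(c g)⁻¹ * c (g + (0, 1)), by simp [hc], by
      rw [hby, map_smul, hF, hy (g + _), smul_smul]⟩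
  have hinj := injective_of_moves hR h.minimal hmE hmF
  have horth : Orthonormal ℂ A := by
    refine ⟨fun g => ?_, fun g g' hne => ?_⟩
    · rw [hy, norm_smul, hc, b.orthonormal.1, one_mul]
    · dsimp only
      rw [hy, hy g', inner_smul_left, inner_smul_right, b.orthonormal.2 (hinj.ne hne), mul_zero,
        mul_zero]
  refine ⟨ofOrthonormal horth, ⟨hR.starRep, fun g => ?_, fun g => ?_, ?_⟩, ?_⟩
  · rw [ofOrthonormal_single, ofOrthonormal_single, hE, hD.scalar_blue]
  · rw [ofOrthonormal_single, ofOrthonormal_single, hF, hD.scalar_red, Circle.coe_one, one_smul]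
  · rw [eq_top_iff, ← b.dense_span]
    refine Submodule.topologicalClosure_mono (Submodule.span_le.2 ?_)
    rintro _ ⟨z, rfl⟩
    obtain ⟨w, g, d, hd, hz⟩ := exists_moves_of_connected hR hmE hmF z
    have hd0 : d ≠ 0 := norm_ne_zero_iff.1 (by simp [hd])
    have hbz : b z = (d⁻¹ * (c g)⁻¹) • GroupData.atom π (ofOrthonormal horth) (g, w) := by
      rw [GroupData.atom, ofOrthonormal_single, mul_smul, ← map_smul (π w), ← hby, hz, smul_smul,
        inv_mul_cancel₀ hd0, one_smul]
    rw [hbz]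
    exact Submodule.smul_mem _ _ (Submodule.subset_span ⟨_, rfl⟩)
  · rw [ofOrthonormal_single, hA0]

end Correspondence

/-! ### Existence of data -/

section ExistenceOfData

variable {m n : ℕ} {θ : Equiv.Perm (Fin m × Fin n)}
variable {H : Type*} [NormedAddCommGroup H] [InnerProductSpace ℂ H] [CompleteSpace H]
variable {π : FTheta θ →* (H →L[ℂ] H)} {ι : Type*} {b : HilbertBasis ι ℂ H}

theorem exists_circle_pow_eq {k : ℕ} (hk : 0 < k) {c : ℂ} (hc : ‖c‖ = 1) :
    ∃ α : Circle, (α : ℂ) ^ k = c := by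
  obtain ⟨a, ha⟩ := IsAlgClosed.exists_pow_nat_eq c hk
  have hn : ‖a‖ = 1 := by
    rw [← ha, norm_pow] at hc
    exact (pow_eq_one_iff_of_nonneg (norm_nonneg _) hk.ne').1 hc
  exact ⟨⟨a, mem_sphere_zero_iff_norm.2 hn⟩, ha⟩

/-- Following the red edges backwards from a vertex on a blue ring, one finds blue rings of the same
size; the words of two of them are related by the red word which leads from one to the other. -/
theorem exists_red_path (hπ : IsStarRep π) (ha : IsAtomic π b) {x : ι} {u : List (Fin m)}
    (hx : Moves π b (eWord θ u) x x) :
    ∃ (y : ℕ → ι) (v : ℕ → Fin n) (w : ℕ → List (Fin m)),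
      (∀ t, Moves π b (f θ (v t)) (y (t + 1)) (y t)) ∧
      (∀ t, (w t).length = u.length ∧ Moves π b (eWord θ (w t)) (y t) (y t)) ∧
      ∀ t, eWord θ (w t) * f θ (v t) = f θ (v t) * eWord θ (w (t + 1)) := by
  have hstep : ∀ p : {p : ι × List (Fin m) //
      p.2.length = u.length ∧ Moves π b (eWord θ p.2) p.1 p.1},
      ∃ (q : {p : ι × List (Fin m) //
        p.2.length = u.length ∧ Moves π b (eWord θ p.2) p.1 p.1}) (j : Fin n),
      Moves π b (f θ j) q.1.1 p.1.1 ∧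
        eWord θ p.1.2 * f θ j = f θ j * eWord θ q.1.2 := by
    rintro ⟨⟨y, w⟩, hl, hw⟩
    obtain ⟨j, y', hj⟩ := ha.exists_red_pred hπ y
    obtain ⟨j', w', hl', hww⟩ := exists_eWord_mul_f (θ := θ) w j
    have h1 := Moves.mul hw hj
    rw [hww] at h1
    obtain ⟨z, h2, h3⟩ := h1.of_mul ha hπ
    obtain ⟨h4, rfl⟩ := hj.unique hπ h3 (by simp) (by simp)
    have h5 : f θ j * 1 = f θ j' * 1 := by rw [h4]
    obtain ⟨rfl, -⟩ := f_mul_inj h5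
    exact ⟨⟨⟨y', w'⟩, hl'.trans hl, h2⟩, j, hj, hww⟩
  choose next lab hmov hcomm using hstep
  let p := fun t : ℕ => next^[t] ⟨⟨x, u⟩, rfl, hx⟩
  have hp : ∀ t, p (t + 1) = next (p t) := fun t => Function.iterate_succ_apply' _ _ _
  refine ⟨fun t => (p t).1.1, fun t => lab (p t), fun t => (p t).1.2, fun t => ?_,
    fun t => (p t).2, fun t => ?_⟩
  · dsimp only
    rw [hp]
    exact hmov _
  · dsimp only
    rw [hp]
    exact hcomm _

/-- Infinitely many of the rings met on the way down from a ring have the same word, because the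
sizes agree; the data are found at the first of these. -/
theorem IsRingByTail.exists_hasData (hR : IsRingByTail π b) :
    ∃ (k : ℕ) (D : RingTailData θ k) (x : ι), HasData π b x D := by
  obtain ⟨x₀⟩ := hR.connected.1
  have hne : (blueReturnLengths π b).Nonempty := by
    obtain ⟨y, u, -, hu, hy⟩ := hR.blue_ring x₀
    exact ⟨_, y, u, hu, rfl, hy⟩
  have hleast : IsLeast (blueReturnLengths π b) (sInf (blueReturnLengths π b)) :=
    ⟨Nat.sInf_mem hne, fun _ h => Nat.sInf_le h⟩
  set k := sInf (blueReturnLengths π b)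
  obtain ⟨x, u, hu, hl, hx⟩ := hleast.1
  have hk : 0 < k := hl ▸ List.length_pos_iff.2 hu
  obtain ⟨y, v, w, hred, hring, hcomm⟩ := exists_red_path hR.starRep hR.atomic hx
  let w' : ℕ → List.Vector (Fin m) k := fun t => ⟨w t, (hring t).1.trans hl⟩
  obtain ⟨u', hu'⟩ := Finite.exists_infinite_fiber w'
  have hinf : (w' ⁻¹' {u'}).Infinite := Set.infinite_coe_iff.1 hu'
  let τ : ℕ → ℕ := Nat.nth fun t => w' t = u'
  have hτmono : StrictMono τ := Nat.nth_strictMono hinf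
  have hτ : ∀ r, w (τ r) = u'.toList := fun r =>
    congrArg Subtype.val (Nat.nth_mem_of_infinite hinf r)
  have hpath : ∀ s l, Moves π b (fWord θ ((List.range l).map fun t => v (s + t)))
      (y (s + l)) (y s) := fun s l => by
    induction l with
    | zero => simpa [fWord] using Moves.one (π := π) (b := b) (y s)
    | succ l ih =>
      rw [List.range_succ, List.map_append, fWord_append, List.map_singleton, fWord_singleton]
      exact ih.mul (hred _)
  have hpathComm : ∀ s l, eWord θ (w s) * fWord θ ((List.range l).map fun t => v (s + t)) =
      fWord θ ((List.range l).map fun t => v (s + t)) * eWord θ (w (s + l)) := fun s l => by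
    induction l with
    | zero => simp [fWord]
    | succ l ih =>
      rw [List.range_succ, List.map_append, fWord_append, List.map_singleton, fWord_singleton,
        ← mul_assoc, ih, mul_assoc, hcomm, ← mul_assoc, add_assoc]
  obtain ⟨c, hc, hcx⟩ := (hring (τ 0)).2
  obtain ⟨α, hα⟩ := exists_circle_pow_eq hk hc
  refine ⟨k, ⟨w (τ 0), (hring _).1.trans hl, hk, α, fun t => v (τ 0 + t),
    fun r => τ (r + 1) - τ 0, fun r => Nat.sub_pos_of_lt (hτmono (Nat.succ_pos r)), ?_, ?_⟩,
    y (τ 0), hleast, ?_, ?_⟩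
  · intro r r' h
    have h1 : τ (r + 1) < τ (r' + 1) := hτmono (Nat.succ_lt_succ h)
    have h2 : τ 0 < τ (r + 1) := hτmono (Nat.succ_pos r)
    dsimp only
    omega
  · intro r
    have h2 : τ 0 < τ (r + 1) := hτmono (Nat.succ_pos r)
    rw [hpathComm, Nat.add_sub_cancel' h2.le, hτ, hτ]
  · rw [hcx, hα]
  · exact fun t => ⟨_, hpath (τ 0) t⟩

end ExistenceOfData

end RankTwo

end

theorem theoremT {m n : ℕ} (θ : Equiv.Perm (Fin m × Fin n)) :
    -- every ring by tail representation has data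
    (∀ {H : Type*} [NormedAddCommGroup H] [InnerProductSpace ℂ H] [CompleteSpace H]
        {ι : Type*} (π : RankTwo.FTheta θ →* (H →L[ℂ] H)) (ξ : HilbertBasis ι ℂ H),
        RankTwo.IsRingByTail π ξ →
        ∃ (k : ℕ) (D : RankTwo.RingTailData θ k) (x : ι), RankTwo.HasData π ξ x D) ∧
    -- the data determine the representation
    (∀ {H : Type*} [NormedAddCommGroup H] [InnerProductSpace ℂ H] [CompleteSpace H]
        {H' : Type*} [NormedAddCommGroup H'] [InnerProductSpace ℂ H'] [CompleteSpace H']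
        {ι : Type*} {ι' : Type*}
        (π : RankTwo.FTheta θ →* (H →L[ℂ] H)) (ξ : HilbertBasis ι ℂ H) (x : ι)
        (π' : RankTwo.FTheta θ →* (H' →L[ℂ] H')) (ξ' : HilbertBasis ι' ℂ H') (x' : ι')
        (k : ℕ) (D : RankTwo.RingTailData θ k),
        RankTwo.IsRingByTail π ξ → RankTwo.HasData π ξ x D →
        RankTwo.IsRingByTail π' ξ' → RankTwo.HasData π' ξ' x' D →
        RankTwo.UnitarilyEquivalent π π') ∧
    -- all data occur
    (∀ (k : ℕ) (D : RankTwo.RingTailData θ k),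
        ∃ (ι : Type)
          (π : RankTwo.FTheta θ →* (RankTwo.EllTwo ι →L[ℂ] RankTwo.EllTwo ι))
          (ξ : HilbertBasis ι ℂ (RankTwo.EllTwo ι)) (x : ι),
          RankTwo.IsRingByTail π ξ ∧ RankTwo.HasData π ξ x D) ∧
    -- a ring by tail representation with given data is the minimal `*`-dilation of a group
    -- construction on `𝒞_k × ℤ` built from these data
    (∀ {H : Type*} [NormedAddCommGroup H] [InnerProductSpace ℂ H] [CompleteSpace H]
        {ι : Type*} (π : RankTwo.FTheta θ →* (H →L[ℂ] H)) (ξ : HilbertBasis ι ℂ H) (x : ι)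
        (k : ℕ) (D : RankTwo.RingTailData θ k),
        RankTwo.IsRingByTail π ξ → RankTwo.HasData π ξ x D →
        ∃ (𝒢 : RankTwo.GroupData θ (ZMod k × ℤ) (1, 0) (0, 1))
          (V : RankTwo.EllTwo (ZMod k × ℤ) →ₗᵢ[ℂ] H),
          RankTwo.Realizes 𝒢 D ∧ RankTwo.IsMinimalStarDilation 𝒢.rep π V ∧
            V (lp.single 2 ((0 : ZMod k), (0 : ℤ)) (1 : ℂ)) = ξ x) ∧
    -- conversely, the minimal `*`-dilation of each group construction on `𝒞_k × ℤ` is a ring by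
    -- tail representation with rings of minimal size `k`
    (∀ (k : ℕ) (_ : 0 < k) (𝒢 : RankTwo.GroupData θ (ZMod k × ℤ) (1, 0) (0, 1))
        {H : Type*} [NormedAddCommGroup H] [InnerProductSpace ℂ H] [CompleteSpace H]
        (π : RankTwo.FTheta θ →* (H →L[ℂ] H))
        (V : RankTwo.EllTwo (ZMod k × ℤ) →ₗᵢ[ℂ] H),
        RankTwo.IsMinimalStarDilation 𝒢.rep π V →
        ∃ (ι : Type) (ξ : HilbertBasis ι ℂ H),
          RankTwo.IsRingByTail π ξ ∧ IsLeast (RankTwo.blueReturnLengths π ξ) k ∧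
            ∀ g : ZMod k × ℤ, ∃ x : ι, ξ x = V (lp.single 2 g (1 : ℂ))) := by
  refine ⟨fun π ξ h => h.exists_hasData, ?_, fun k D => ?_, ?_, ?_⟩
  · intro H _ _ _ H' _ _ _ ι ι' π ξ x π' ξ' x' k D h hD h' hD'
    obtain ⟨V, hV, -⟩ := hD.exists_isCarrier h D.realizes_groupData
    obtain ⟨V', hV', -⟩ := hD'.exists_isCarrier h' D.realizes_groupData
    exact hV.unitarilyEquivalent hV'
  · have hV := D.groupData.isCarrier_model (α := D.α) (fun _ => rfl) (fun _ => rfl)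
    exact ⟨D.groupData.Vertex, _, hV.basis, D.groupData.vertex 0, hV.isRingByTail D.k_pos,
      hV.hasData D.realizes_groupData⟩
  · intro H _ _ _ ι π ξ x k D h hD
    obtain ⟨V, hV, hx⟩ := hD.exists_isCarrier h D.realizes_groupData
    exact ⟨D.groupData, V, D.realizes_groupData, hV.isMinimalStarDilation, hx⟩
  · intro k hk 𝒢 H _ _ _ π V h
    have hV := RankTwo.GroupData.isCarrier_of_isMinimalStarDilation h
    exact ⟨𝒢.Vertex, hV.basis, hV.isRingByTail hk, hV.isLeast hk,
      fun g => ⟨𝒢.vertex g, hV.basis_vertex g⟩⟩
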